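/- Let $1\le m\le n$ and let $M_{m,n}(\mathbb{C})\cong\mathbb{C}^{mn}$ be the space of complex $m\times n$ matrices. Let $Q_1\subseteq\{1,\dots,n\}^2$ be a reflexive and transitive relation with $|Q_1|=mn-m^2+1$, and let $$G_R=\{B\in \mathrm{GL}_n(\mathbb{C}) : B_{ij}=0\text{ whenever }(i,j)\notin Q_1\},$$ which is a group. Let $G=\mathrm{GL}_m(\mathbb{C})\times G_R$ act on $M_{m,n}(\mathbb{C})$ by $(A,B)\cdot M=AMB^{-1}$, and let $\mathfrak{g}\subseteq\mathfrak{gl}(M_{m,n}(\mathbb{C}))$ be the Lie algebra of the image of $G$ in $\mathrm{GL}(M_{m,n}(\mathbb{C}))$ (that is, of $G$ modulo the scalars $Z=\mathbb{C}^*\cdot(I_m,I_n)$ acting trivially). Then $\dim_{\mathbb{C}}\mathfrak{g}=mn$. For a basis $A_1,\dots,A_{mn}$ of $\mathfrak{g}$ let $\Delta(x)=\det\bigl(A_1x,\dots,A_{mn}x\bigr)\in\mathbb{C}[M_{m,n}]$ be the discriminant determinant of the action of $G$; it is determined up to a nonzero constant factor. A reduced divisor $D\subset\mathbb{C}^N$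 with reduced (holomorphic) defining equation $f$ is called a linear free divisor if the sheaf $\mathrm{Der}(-\log D)$ of holomorphic vector fields $\delta$ with $\delta(f)\in\mathcal{O}\cdot f$ is a locally free $\mathcal{O}$-module and its module of global sections has, over the ring of entire functions, a basis of vector fields with linear coefficients. 1. If $\Delta$ is not identically zero and the action of $G$ preserves the divisors of zeros of precisely $n$ distinct $m\times m$ minors of the generic $m\times n$ matrix, then the union $D$ of these divisors is a linear free divisor, and $D=V(\Delta)$, where $\Delta$ is a reduced equation of $D$. 2. If the action of $G$ preserves the divisors of zeros of more than $n$ distinct $m\times m$ minors, then $\Delta$ is identically zero. -/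

import Mathlib

open Matrix

/-! ### Linear free divisors in affine space -/

/-- Coordinates are indexed by a finite type `ι`, so the ambient space is `ι → ℂ`. A function is
holomorphic on an open set `U` when it is complex differentiable there.

`IsReducedEquation f D`: the entire function `f` is a (global) defining equation of the reduced
divisor `D`, that is, `D` is a proper subset of the space, `f` vanishes exactly on `D`, and over
every open set `f` generates the ideal of the holomorphic functions that vanish on `D`. -/
def IsReducedEquation {ι : Type*} [Fintype ι] (f : (ι → ℂ) → ℂ) (D : Set (ι → ℂ)) : Prop :=
  Differentiable ℂ f ∧ D ≠ Set.univ ∧ D = {x | f x = 0} ∧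
    ∀ (U : Set (ι → ℂ)) (g : (ι → ℂ) → ℂ), IsOpen U → DifferentiableOn ℂ g U →
      (∀ x ∈ U, x ∈ D → g x = 0) →
        ∃ q : (ι → ℂ) → ℂ, DifferentiableOn ℂ q U ∧ ∀ x ∈ U, g x = q x * f x

/-- `δ` is, over the open set `U`, a section of the sheaf of logarithmic vector fields along the
divisor with equation `f`: it is holomorphic on `U`, and the derivative of `f` along `δ` is a
holomorphic multiple of `f` on `U`. -/
def IsLogVectorField {ι : Type*} [Fintype ι] (f : (ι → ℂ) → ℂ) (U : Set (ι → ℂ))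
    (δ : (ι → ℂ) → (ι → ℂ)) : Prop :=
  DifferentiableOn ℂ δ U ∧
    ∃ q : (ι → ℂ) → ℂ, DifferentiableOn ℂ q U ∧ ∀ x ∈ U, fderiv ℂ f x (δ x) = q x * f x

/-- The family `δ` is, over the open set `U`, a basis of the module of logarithmic vector fields
over the ring of holomorphic functions on `U`. -/
def IsLogBasis {ι κ : Type*} [Fintype ι] [Fintype κ] (f : (ι → ℂ) → ℂ) (U : Set (ι → ℂ))
    (δ : κ → (ι → ℂ) → (ι → ℂ)) : Prop :=
  (∀ k, IsLogVectorField f U (δ k)) ∧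
  (∀ η : (ι → ℂ) → (ι → ℂ), IsLogVectorField f U η →
    ∃ h : κ → (ι → ℂ) → ℂ, (∀ k, DifferentiableOn ℂ (h k) U) ∧
      ∀ x ∈ U, η x = ∑ k, h k x • δ k x) ∧
  (∀ h : κ → (ι → ℂ) → ℂ, (∀ k, DifferentiableOn ℂ (h k) U) →
    (∀ x ∈ U, ∑ k, h k x • δ k x = 0) → ∀ k, ∀ x ∈ U, h k x = 0)

/-- The sheaf of logarithmic vector fields along the divisor with equation `f` is locally free. -/
def IsLocallyFreeLog {ι : Type*} [Fintype ι] (f : (ι → ℂ) → ℂ) : Prop :=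
  ∀ p : ι → ℂ, ∃ U : Set (ι → ℂ), IsOpen U ∧ p ∈ U ∧
    ∃ (r : ℕ) (δ : Fin r → (ι → ℂ) → (ι → ℂ)),
      ∀ V : Set (ι → ℂ), IsOpen V → V ⊆ U → IsLogBasis f V δ

/-- `D` is a linear free divisor: a reduced divisor whose sheaf of logarithmic vector fields is
locally free, and whose module of global logarithmic vector fields has a basis consisting of
linear vector fields `x ↦ B k *ᵥ x`. -/
def IsLinearFreeDivisor {ι : Type*} [Fintype ι] (D : Set (ι → ℂ)) : Prop :=
  ∃ f : (ι → ℂ) → ℂ, IsReducedEquation f D ∧ IsLocallyFreeLog f ∧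
    ∃ B : ι → Matrix ι ι ℂ, IsLogBasis f Set.univ (fun k x => B k *ᵥ x)

/-! ### Lie algebras of linear algebraic groups and the discriminant determinant -/

/-- The Lie algebra of a linear algebraic group `H ⊆ GL_ι(ℂ)`, as a space of matrices: the Zariski
tangent space at the identity, that is, all `X` such that for every polynomial `p` in the matrix
entries that vanishes on `H` the differential of `p` at the identity vanishes on `X`
(equivalently, `1 + ε X` with `ε ^ 2 = 0` satisfies all the equations of `H`). -/
def lieAlgebraOf {ι : Type*} [Fintype ι] [DecidableEq ι] (H : Subgroup (GL ι ℂ)) :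
    Submodule ℂ (Matrix ι ι ℂ) where
  carrier := {X | ∀ p : MvPolynomial (ι × ι) ℂ,
    (∀ g ∈ H, MvPolynomial.eval (fun q => (g : Matrix ι ι ℂ) q.1 q.2) p = 0) →
      ∑ q : ι × ι, MvPolynomial.eval (fun q => (1 : Matrix ι ι ℂ) q.1 q.2)
        (MvPolynomial.pderiv q p) * X q.1 q.2 = 0}
  zero_mem' := by
    intro p _
    simp
  add_mem' := by
    intro X Y hX hY p hp
    simp only [Matrix.add_apply, mul_add, Finset.sum_add_distrib, hX p hp, hY p hp, add_zero]
  smul_mem' := by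
    intro c X hX p hp
    have h := hX p hp
    simp only [Matrix.smul_apply, smul_eq_mul, mul_left_comm _ c, ← Finset.mul_sum, h, mul_zero]

/-- The discriminant determinant `Δ = det (A₁ x, …, A_N x)` of a linear algebraic group acting on
`ι → ℂ`, for a basis `A` of its Lie algebra; it is a polynomial in the coordinates `x`, and a
change of basis multiplies it by a nonzero constant. -/
noncomputable def discriminantDet {ι : Type*} [Fintype ι] [DecidableEq ι]
    {L : Submodule ℂ (Matrix ι ι ℂ)} (A : Module.Basis ι ℂ L) : MvPolynomial ι ℂ :=
  (Matrix.of fun i k : ι =>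
    ∑ j, MvPolynomial.C ((A k : Matrix ι ι ℂ) i j) * MvPolynomial.X j).det

/-! ### The group acting on the space of matrices -/

/-- For a reflexive and transitive set `Q` of arrows on the vertices `0, …, n - 1`, the group of
the invertible matrices all of whose entries outside `Q` vanish. -/
def quiverGroup {n : ℕ} (Q : Finset (Fin n × Fin n)) (hrefl : ∀ i, (i, i) ∈ Q)
    (htrans : ∀ i j k, (i, j) ∈ Q → (j, k) ∈ Q → (i, k) ∈ Q) : Subgroup (GL (Fin n) ℂ) where
  carrier := {B | ∀ i j, (i, j) ∉ Q → (B : Matrix (Fin n) (Fin n) ℂ) i j = 0}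
  one_mem' := by
    intro i j hij
    have : i ≠ j := by
      rintro rfl
      exact hij (hrefl i)
    simp [Matrix.one_apply_ne this]
  mul_mem' := by
    intro B C hB hC i j hij
    rw [Units.val_mul, Matrix.mul_apply]
    refine Finset.sum_eq_zero fun k _ => ?_
    by_cases h : (i, k) ∈ Q
    · rw [hC k j (fun h' => hij (htrans i k j h h')), mul_zero]
    · rw [hB i k h, zero_mul]
  inv_mem' := by
    intro B hB
    let S : Submodule ℂ (Matrix (Fin n) (Fin n) ℂ) :=
      { carrier := {X | ∀ i j, (i, j) ∉ Q → X i j = 0}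
        zero_mem' := fun _ _ _ => rfl
        add_mem' := by
          intro X Y hX hY i j hij
          simp [hX i j hij, hY i j hij]
        smul_mem' := by
          intro c X hX i j hij
          simp [hX i j hij] }
    have hS : ∀ X ∈ S, LinearMap.mulLeft ℂ (B : Matrix (Fin n) (Fin n) ℂ) X ∈ S := by
      intro X hX i j hij
      rw [LinearMap.mulLeft_apply, Matrix.mul_apply]
      refine Finset.sum_eq_zero fun k _ => ?_
      by_cases h : (i, k) ∈ Q
      · rw [hX k j (fun h' => hij (htrans i k j h h')), mul_zero]
      · rw [hB i k h, zero_mul]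
    have hinj : Function.Injective
        ((LinearMap.mulLeft ℂ (B : Matrix (Fin n) (Fin n) ℂ)).restrict hS) := by
      intro X Y hXY
      have h := congrArg Subtype.val hXY
      simp only [LinearMap.coe_restrict_apply, LinearMap.mulLeft_apply] at h
      exact Subtype.ext (B.isUnit.mul_left_cancel h)
    have hone : (1 : Matrix (Fin n) (Fin n) ℂ) ∈ S := by
      intro i j hij
      have : i ≠ j := by
        rintro rfl
        exact hij (hrefl i)
      exact Matrix.one_apply_ne this
    obtain ⟨X, hX⟩ := LinearMap.injective_iff_surjective.mp hinj ⟨1, hone⟩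
    have h : (B : Matrix (Fin n) (Fin n) ℂ) * X = 1 := by
      have := congrArg Subtype.val hX
      simpa only [LinearMap.coe_restrict_apply, LinearMap.mulLeft_apply] using this
    have hval : ((B⁻¹ : GL (Fin n) ℂ) : Matrix (Fin n) (Fin n) ℂ) = X :=
      Units.inv_eq_of_mul_eq_one_right h
    intro i j hij
    rw [hval]
    exact X.2 i j hij

/-- The `m × n` matrix with the coordinates `x`. -/
def toMat {m n : ℕ} (x : Fin m × Fin n → ℂ) : Matrix (Fin m) (Fin n) ℂ :=
  Matrix.of fun i j => x (i, j)

/-- The action `(A, B) · M = A M B⁻¹` of `GL_m(ℂ) × G_R`, for a group `G_R ⊆ GL_n(ℂ)`, on the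
space of `m × n` matrices, in coordinates: the linear map `x ↦ (A, B) · x`. -/
def actLin {m n : ℕ} {R : Subgroup (GL (Fin n) ℂ)} (g : GL (Fin m) ℂ × R) :
    (Fin m × Fin n → ℂ) →ₗ[ℂ] (Fin m × Fin n → ℂ) where
  toFun x := fun q =>
    ((g.1 : Matrix (Fin m) (Fin m) ℂ) * toMat x *
      (((g.2 : GL (Fin n) ℂ)⁻¹ : GL (Fin n) ℂ) : Matrix (Fin n) (Fin n) ℂ)) q.1 q.2
  map_add' x y := by
    have h : toMat (x + y) = toMat x + toMat y := rfl
    funext q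
    rw [h, Matrix.mul_add, Matrix.add_mul]
    rfl
  map_smul' c x := by
    have h : toMat (c • x) = c • toMat x := rfl
    funext q
    rw [h, Matrix.mul_smul, Matrix.smul_mul]
    rfl

/-- The linear representation of `GL_m(ℂ) × G_R` on the space of `m × n` matrices. -/
noncomputable def actHom {m n : ℕ} (R : Subgroup (GL (Fin n) ℂ)) :
    GL (Fin m) ℂ × R →* GL (Fin m × Fin n) ℂ :=
  MonoidHom.toHomUnits
    { toFun := fun g => LinearMap.toMatrix' (actLin g)
      map_one' := by
        have h : actLin (1 : GL (Fin m) ℂ × R) = LinearMap.id := by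
          ext x q
          simp [actLin, toMat]
        rw [h, LinearMap.toMatrix'_id]
      map_mul' := by
        intro g h
        have e : actLin (g * h) = (actLin g) ∘ₗ (actLin h) := by
          refine LinearMap.ext fun x => ?_
          funext q
          have hx : toMat (actLin h x) = (h.1 : Matrix (Fin m) (Fin m) ℂ) * toMat x *
              (((h.2 : GL (Fin n) ℂ)⁻¹ : GL (Fin n) ℂ) : Matrix (Fin n) (Fin n) ℂ) := rfl
          rw [LinearMap.comp_apply]
          change _ = ((g.1 : Matrix (Fin m) (Fin m) ℂ) * toMat (actLin h x) *
            (((g.2 : GL (Fin n) ℂ)⁻¹ : GL (Fin n) ℂ) : Matrix (Fin n) (Fin n) ℂ)) q.1 q.2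
          rw [hx]
          simp only [actLin, LinearMap.coe_mk, AddHom.coe_mk, Prod.fst_mul, Prod.snd_mul,
            Subgroup.coe_mul, _root_.mul_inv_rev, Units.val_mul, Matrix.mul_assoc]
        rw [e, LinearMap.toMatrix'_comp] }

/-- The Lie algebra of `GL_m(ℂ) × G_R` modulo the kernel of its action on the `m × n` matrices,
that is, of the image of this group in the general linear group of the space of matrices. -/
noncomputable def actingLieAlgebra (m : ℕ) {n : ℕ} (R : Subgroup (GL (Fin n) ℂ)) :
    Submodule ℂ (Matrix (Fin m × Fin n) (Fin m × Fin n) ℂ) :=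
  lieAlgebraOf (actHom (m := m) R).range

/-- The divisor of zeros of the `m × m` minor with the columns `σ 0 < σ 1 < ⋯ < σ (m - 1)`. The
strictly increasing maps `σ` correspond to the `m`-element sets of columns, so distinct `σ` are
distinct minors. -/
def minorDivisor {m n : ℕ} (σ : Fin m ↪o Fin n) : Set (Fin m × Fin n → ℂ) :=
  {x | ((toMat x).submatrix id σ).det = 0}

/-- The `m × m` minors whose divisor of zeros is preserved by the action of `GL_m(ℂ) × G_R`. -/
def preservedMinors (m : ℕ) {n : ℕ} (R : Subgroup (GL (Fin n) ℂ)) : Set (Fin m ↪o Fin n) :=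
  {σ | ∀ g : GL (Fin m) ℂ × R, (fun x => actLin g x) '' minorDivisor σ = minorDivisor σ}

/-!
If a group `H` of linear maps preserves a divisor `D` with homogeneous reduced equation `F`, then
`F ∘ h` is a constant multiple of `F` for every `h ∈ H`. Differentiating, every element of the Lie
algebra of `H` is a linear vector field logarithmic along `D`, hence tangent to `D` at its smooth
points. So `N` of these fields on `ℂ^N` are linearly dependent along `D`, and `Δ = q * F` with `q`
holomorphic. Comparing homogeneous degrees, `Δ = 0` if `deg F > N`, and `q` is constant if
`deg F = N`; in the second case, if `Δ ≠ 0`, Saito's criterion shows that the fields form a basis of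
the logarithmic vector fields, by Cramer's rule.

The maximal minors of the generic matrix are irreducible and pairwise non-associated, so a product
of `k` distinct ones is squarefree of degree `m * k`. That a squarefree polynomial `F` generates the
ideal of the holomorphic functions `g` vanishing on its zero set is seen on the lines in a generic
direction: on almost all of them `F` has simple roots and divides `g`, and the quotients are glued
by a Cauchy integral, which depends holomorphically on the line.
-/

/-! ### Holomorphic functions of several variables -/

section SeveralVariables

variable {E : Type*} [NormedAddCommGroup E] [NormedSpace ℂ E] {O : Set E} {Φ : E → ℂ}

theorem dense_setOf_ne_zero_of_differentiable {f : E → ℂ} (hf : Differentiable ℂ f) {x₀ : E}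
    (hx₀ : f x₀ ≠ 0) : Dense {x | f x ≠ 0} := by
  rw [← Set.compl_ofPred, ← interior_eq_empty_iff_dense_compl, Set.eq_empty_iff_forall_notMem]
  intro p hp
  let line : ℂ → E := fun t => p + t • (x₀ - p)
  have hline : Continuous line := by fun_prop
  have hentire : AnalyticOnNhd ℂ (f ∘ line) Set.univ :=
    (hf.comp (by fun_prop : Differentiable ℂ line)).differentiableOn.analyticOnNhd isOpen_univ
  have hzero : f ∘ line =ᶠ[nhds 0] 0 := by
    filter_upwards [hline.continuousAt.preimage_mem_nhds
      (by simpa [line] using mem_interior_iff_mem_nhds.mp hp)] with t ht using ht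
  have h1 := hentire.eqOn_zero_of_preconnected_of_eventuallyEq_zero isPreconnected_univ
    (Set.mem_univ 0) hzero (Set.mem_univ 1)
  exact hx₀ (by simpa [line] using h1)

theorem isOpen_setOf_forall_add_smul_mem (hO : IsOpen O) {K : Set ℂ} (hK : IsCompact K) (v : E) :
    IsOpen {y | ∀ t ∈ K, y + t • v ∈ O} := by
  refine isOpen_iff_mem_nhds.mpr fun y hy =>
    hK.eventually_forall_of_forall_eventually fun t ht => ?_
  have hcont : Continuous fun z : E × ℂ => z.1 + z.2 • v := by fun_prop
  exact hcont.continuousAt.eventually_mem (hO.mem_nhds (hy t ht))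

theorem exists_thickening_norm_fderiv_le [ProperSpace E] (hO : IsOpen O)
    (hΦ : DifferentiableOn ℂ Φ O) {K : Set E} (hK : IsCompact K) (hKO : K ⊆ O) :
    ∃ δ > 0, ∃ C, Metric.thickening δ K ⊆ O ∧
      ∀ z ∈ Metric.thickening δ K, ‖fderiv ℂ Φ z‖ ≤ C := by
  obtain ⟨δ, hδ, hKδ⟩ := hK.exists_cthickening_subset_open hO hKO
  obtain ⟨C, hC⟩ := (hK.cthickening (r := δ)).exists_bound_of_continuousOn
    (hΦ.continuousOn.mono hKδ)
  have hball : ∀ z ∈ Metric.thickening (δ / 2) K, Metric.ball z (δ / 2) ⊆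
      Metric.cthickening δ K := by
    intro z hz w hw
    obtain ⟨k, hk, hzk⟩ := Metric.mem_thickening_iff.mp hz
    refine Metric.mem_cthickening_of_dist_le w k δ K hk ?_
    linarith [dist_triangle w z k, Metric.mem_ball.mp hw]
  refine ⟨δ / 2, half_pos hδ, 2 * C / (δ / 2), fun z hz =>
    hKδ (hball z hz (Metric.mem_ball_self (half_pos hδ))), fun z hz => ?_⟩
  refine Complex.norm_fderiv_le_div_of_mapsTo_ball (hΦ.mono ((hball z hz).trans hKδ)) ?_
    (half_pos hδ)
  intro w hw
  rw [mem_closedBall_iff_norm]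
  linarith [norm_sub_le (Φ w) (Φ z), hC w (hball z hz hw),
    hC z (hball z hz (Metric.mem_ball_self (half_pos hδ)))]

theorem exists_closedBall_add_smul_mem (hO : IsOpen O) (v : E) {p : E} (hp : p ∈ O) :
    ∃ r > 0, ∀ t ∈ Metric.closedBall (0 : ℂ) r, p + t • v ∈ O := by
  have hcont : Continuous fun t : ℂ => p + t • v := by fun_prop
  have hnear : ∀ᶠ t : ℂ in nhds 0, p + t • v ∈ O :=
    hcont.continuousAt.eventually_mem (by simpa using hO.mem_nhds hp)
  obtain ⟨r, hr, h⟩ := Metric.nhds_basis_closedBall.eventually_iff.mp hnear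
  exact ⟨r, hr, fun t ht => h ht⟩

theorem fderiv_apply_eq_circleIntegral {r : ℝ} (hr : 0 < r) (hO : IsOpen O)
    (hΦ : DifferentiableOn ℂ Φ O) {p v : E}
    (hp : ∀ t ∈ Metric.closedBall (0 : ℂ) r, p + t • v ∈ O) :
    fderiv ℂ Φ p v = (2 * Real.pi * Complex.I)⁻¹ *
      ∮ t in C(0, r), ((t - 0) ^ 2)⁻¹ * Φ (p + t • v) := by
  have hp0 : p + (0 : ℂ) • v ∈ O := hp 0 (Metric.mem_closedBall_self hr.le)
  have hd : HasDerivAt (fun t : ℂ => Φ (p + t • v)) (fderiv ℂ Φ p v) 0 := by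
    have h1 : HasFDerivAt Φ (fderiv ℂ Φ p) (p + (0 : ℂ) • v) := by
      simp only [zero_smul, add_zero] at hp0 ⊢
      exact ((hΦ _ hp0).differentiableAt (hO.mem_nhds hp0)).hasFDerivAt
    simpa [Function.comp_def] using
      h1.comp_hasDerivAt (0 : ℂ) (((hasDerivAt_id 0).smul_const v).const_add p)
  have := Complex.two_pi_I_inv_smul_circleIntegral_sub_sq_inv_smul_of_differentiable
    (hO.preimage (by fun_prop : Continuous fun t : ℂ => p + t • v)) hp
    (hΦ.comp (by fun_prop : Differentiable ℂ fun t : ℂ => p + t • v).differentiableOn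
      fun t ht => ht) (Metric.mem_ball_self hr)
  rw [← hd.deriv]
  exact this.symm

variable [FiniteDimensional ℂ E]

theorem differentiableAt_intervalIntegral_mul_comp_add (hO : IsOpen O)
    (hΦ : DifferentiableOn ℂ Φ O) {k : ℝ → ℂ} (hk : Continuous k) {c : ℝ → E} (hc : Continuous c)
    {p : E} {a b : ℝ} (hp : ∀ θ ∈ Set.uIcc a b, p + c θ ∈ O) :
    DifferentiableAt ℂ (fun y => ∫ θ in a..b, k θ * Φ (y + c θ)) p := by
  have : ProperSpace E := FiniteDimensional.proper ℂ E
  obtain ⟨δ, hδ, C, hsub, hC⟩ := exists_thickening_norm_fderiv_le hO hΦ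
    (isCompact_uIcc.image (by fun_prop : Continuous fun θ => p + c θ))
    (Set.image_subset_iff.mpr hp)
  have hmem : ∀ y ∈ Metric.ball p δ, ∀ θ ∈ Set.uIcc a b,
      y + c θ ∈ Metric.thickening δ ((fun θ => p + c θ) '' Set.uIcc a b) := fun y hy θ hθ =>
    Metric.mem_thickening_iff.mpr ⟨_, ⟨θ, hθ, rfl⟩, by simpa using hy⟩
  have hcont : ∀ y ∈ Metric.ball p δ,
      ContinuousOn (fun θ => k θ * Φ (y + c θ)) (Set.uIcc a b) := fun y hy =>
    hk.continuousOn.mul (hΦ.continuousOn.comp (by fun_prop) fun θ hθ => hsub (hmem y hy θ hθ))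
  obtain ⟨B, hB⟩ := isCompact_uIcc.exists_bound_of_continuousOn (s := Set.uIcc a b)
    hk.continuousOn
  borelize E
  refine (intervalIntegral.hasFDerivAt_integral_of_dominated_of_fderiv_le (𝕜 := ℂ)
    (F' := fun y θ => k θ • fderiv ℂ Φ (y + c θ)) (bound := fun _ => B * C)
    (Metric.ball_mem_nhds p hδ) ?_ ?_ ?_ ?_ intervalIntegrable_const ?_).differentiableAt
  · filter_upwards [Metric.ball_mem_nhds p hδ] with y hy
    exact ((hcont y hy).mono Set.uIoc_subset_uIcc).aestronglyMeasurable measurableSet_uIoc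
  · exact (hcont p (Metric.mem_ball_self hδ)).intervalIntegrable
  · exact hk.aestronglyMeasurable.smul ((measurable_fderiv ℂ Φ).comp
      (by fun_prop : Continuous fun θ => p + c θ).measurable).aestronglyMeasurable
  · refine Filter.Eventually.of_forall fun θ hθ y hy => ?_
    have hθ' := Set.uIoc_subset_uIcc hθ
    rw [norm_smul]
    exact mul_le_mul (hB θ hθ') (hC _ (hmem y hy θ hθ')) (norm_nonneg _)
      ((norm_nonneg _).trans (hB θ hθ'))
  · refine Filter.Eventually.of_forall fun θ hθ y hy => ?_
    have hO' := hsub (hmem y hy θ (Set.uIoc_subset_uIcc hθ))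
    have hd := ((hΦ _ hO').differentiableAt (hO.mem_nhds hO')).hasFDerivAt
    exact (hd.comp y ((hasFDerivAt_id y).add_const (c θ))).const_mul (k θ)

theorem differentiableAt_circleIntegral_mul_comp_add_smul (hO : IsOpen O)
    (hΦ : DifferentiableOn ℂ Φ O) {r : ℝ} (hr : 0 ≤ r) {φ : ℂ → ℂ}
    (hφ : ContinuousOn φ (Metric.sphere 0 r)) {p v : E}
    (hp : ∀ t ∈ Metric.sphere (0 : ℂ) r, p + t • v ∈ O) :
    DifferentiableAt ℂ (fun y => ∮ t in C(0, r), φ t * Φ (y + t • v)) p := by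
  have hk : Continuous fun θ => deriv (circleMap 0 r) θ * φ (circleMap 0 r θ) :=
    (by simp only [deriv_circleMap]; fun_prop :
      Continuous fun θ => deriv (circleMap 0 r) θ).mul
      (hφ.comp_continuous (by fun_prop) fun θ => circleMap_mem_sphere 0 hr θ)
  have hc : Continuous fun θ => circleMap 0 r θ • v :=
    (continuous_circleMap 0 r).smul continuous_const
  have hparam := differentiableAt_intervalIntegral_mul_comp_add hO hΦ hk hc (a := 0)
    (b := 2 * Real.pi) fun θ _ => hp _ (circleMap_mem_sphere 0 hr θ)
  simpa only [circleIntegral, smul_eq_mul, mul_assoc] using hparam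

theorem differentiableOn_fderiv_apply (hO : IsOpen O) (hΦ : DifferentiableOn ℂ Φ O) (v : E) :
    DifferentiableOn ℂ (fun y => fderiv ℂ Φ y v) O := by
  intro p hp
  obtain ⟨r, hr, hpr⟩ := exists_closedBall_add_smul_mem hO v hp
  have heq : (fun y => fderiv ℂ Φ y v) =ᶠ[nhds p] fun y => (2 * Real.pi * Complex.I)⁻¹ *
      ∮ t in C(0, r), ((t - 0) ^ 2)⁻¹ * Φ (y + t • v) := by
    filter_upwards [(isOpen_setOf_forall_add_smul_mem hO
      (isCompact_closedBall (0 : ℂ) r) v).mem_nhds hpr] with y hy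
    exact fderiv_apply_eq_circleIntegral hr hO hΦ hy
  refine (DifferentiableAt.congr_of_eventuallyEq ?_ heq).differentiableWithinAt
  refine (differentiableAt_circleIntegral_mul_comp_add_smul hO hΦ hr.le ?_ fun t ht =>
    hpr t (Metric.sphere_subset_closedBall ht)).const_mul _
  refine ContinuousOn.inv₀ (by fun_prop) fun t ht => ?_
  have : t ≠ 0 := ne_of_mem_of_not_mem ht (by simp [hr.ne])
  simpa using this

end SeveralVariables

/-! ### Division of holomorphic functions -/

theorem exists_eq_mul_prod_sub {O : Set ℂ} (hO : IsOpen O) {γ : ℂ → ℂ}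
    (hγ : DifferentiableOn ℂ γ O) (s : Finset ℂ) (hs : ∀ a ∈ s, a ∈ O → γ a = 0) :
    ∃ h : ℂ → ℂ, DifferentiableOn ℂ h O ∧ ∀ t ∈ O, γ t = h t * ∏ a ∈ s, (t - a) := by
  induction s using Finset.induction_on with
  | empty => exact ⟨γ, hγ, by simp⟩
  | insert a s ha ih =>
    obtain ⟨h, hd, he⟩ := ih fun b hb => hs b (Finset.mem_insert_of_mem hb)
    by_cases haO : a ∈ O
    · have h0 : h a = 0 := by
        have hγa := he a haO
        rw [hs a (Finset.mem_insert_self _ _) haO] at hγa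
        refine (mul_eq_zero.mp hγa.symm).resolve_right (Finset.prod_ne_zero_iff.mpr ?_)
        exact fun b hb => sub_ne_zero.mpr (ne_of_mem_of_not_mem hb ha).symm
      refine ⟨dslope h a, (Complex.differentiableOn_dslope (hO.mem_nhds haO)).mpr hd,
        fun t ht => ?_⟩
      have hslope : (t - a) * dslope h a t = h t := by
        simpa [h0] using sub_smul_dslope h a t
      rw [Finset.prod_insert ha, he t ht, ← hslope]
      ring
    · have hne : ∀ t ∈ O, t - a ≠ 0 := fun t ht =>
        sub_ne_zero.mpr (ne_of_mem_of_not_mem ht haO)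
      refine ⟨fun t => h t / (t - a), hd.div (by fun_prop) hne, fun t ht => ?_⟩
      rw [Finset.prod_insert ha, he t ht, ← mul_assoc, div_mul_cancel₀ _ (hne t ht)]

theorem eval_eq_leadingCoeff_mul_prod_of_separable {K : Type*} [Field K] [IsAlgClosed K]
    [DecidableEq K] {P : Polynomial K} (hP : P.Separable) (t : K) :
    P.eval t = P.leadingCoeff * ∏ a ∈ P.roots.toFinset, (t - a) := by
  have hnodup := Polynomial.nodup_roots hP
  conv_lhs => rw [(IsAlgClosed.splits P).eq_prod_roots]
  rw [Finset.prod_eq_multiset_prod, Multiset.toFinset_val, hnodup.dedup]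
  simp [Polynomial.eval_multiset_prod, Multiset.map_map]

theorem exists_eq_mul_eval_of_separable {O : Set ℂ} (hO : IsOpen O) {γ : ℂ → ℂ}
    (hγ : DifferentiableOn ℂ γ O) {P : Polynomial ℂ} (hP : P.Separable)
    (hroot : ∀ a ∈ O, P.eval a = 0 → γ a = 0) :
    ∃ h : ℂ → ℂ, DifferentiableOn ℂ h O ∧ ∀ t ∈ O, γ t = h t * P.eval t := by
  obtain ⟨h, hd, he⟩ := exists_eq_mul_prod_sub hO hγ P.roots.toFinset fun a ha haO =>
    hroot a haO (Polynomial.isRoot_of_mem_roots (Multiset.mem_toFinset.mp ha))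
  have hlead : P.leadingCoeff ≠ 0 := Polynomial.leadingCoeff_ne_zero.mpr hP.ne_zero
  refine ⟨fun t => h t / P.leadingCoeff, hd.div_const _, fun t ht => ?_⟩
  rw [he t ht, eval_eq_leadingCoeff_mul_prod_of_separable hP]
  field_simp

theorem eq_circleIntegral_div_mul_eval {O : Set ℂ} (hO : IsOpen O) {γ : ℂ → ℂ}
    (hγ : DifferentiableOn ℂ γ O) {P : Polynomial ℂ} (hP : P.Separable)
    (hroot : ∀ a ∈ O, P.eval a = 0 → γ a = 0) {r : ℝ} (hr : 0 < r)
    (hball : Metric.closedBall 0 r ⊆ O) (hsphere : ∀ t ∈ Metric.sphere (0 : ℂ) r, P.eval t ≠ 0) :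
    γ 0 = (2 * Real.pi * Complex.I)⁻¹ * (∮ t in C(0, r), (t - 0)⁻¹ * (γ t / P.eval t)) *
      P.eval 0 := by
  obtain ⟨h, hd, he⟩ := exists_eq_mul_eval_of_separable hO hγ hP hroot
  have hint : (∮ t in C(0, r), (t - 0)⁻¹ * (γ t / P.eval t)) = ∮ t in C(0, r), (t - 0)⁻¹ • h t := by
    refine circleIntegral.integral_congr hr.le fun t ht => ?_
    simp only [he t (hball (Metric.sphere_subset_closedBall ht)),
      mul_div_cancel_right₀ _ (hsphere t ht), smul_eq_mul]
  rw [hint, (hd.mono hball).circleIntegral_sub_inv_smul (Metric.mem_ball_self hr), smul_eq_mul,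
    inv_mul_cancel_left₀ Complex.two_pi_I_ne_zero]
  exact he 0 (hball (Metric.mem_closedBall_self hr.le))

theorem exists_radius_forall_sphere_eval_ne_zero {P : Polynomial ℂ} (hP : P ≠ 0) {ρ : ℝ}
    (hρ : 0 < ρ) : ∃ r, 0 < r ∧ r ≤ ρ ∧ ∀ t ∈ Metric.sphere (0 : ℂ) r, P.eval t ≠ 0 := by
  obtain ⟨r, hr, hroots⟩ := (Set.Ioc_infinite hρ).exists_notMem_finite
    ((P.rootSet_finite ℂ).image norm)
  refine ⟨r, hr.1, hr.2, fun t ht h0 => hroots ⟨t, ?_, by simpa using ht⟩⟩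
  simpa [Polynomial.mem_rootSet, hP] using h0

section Division

variable {E : Type*} [NormedAddCommGroup E] [NormedSpace ℂ E] {U : Set E} {f g : E → ℂ}

theorem differentiableOn_circleIntegral_div_comp_add_smul [FiniteDimensional ℂ E] (hU : IsOpen U)
    (hf : Differentiable ℂ f) (hg : DifferentiableOn ℂ g U) {r : ℝ} (hr : 0 < r) (v : E) :
    DifferentiableOn ℂ (fun y => ∮ t in C(0, r), (t - 0)⁻¹ * (g (y + t • v) / f (y + t • v)))
      {y | ∀ t ∈ Metric.sphere (0 : ℂ) r, y + t • v ∈ U ∩ {x | f x ≠ 0}} := by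
  intro y hy
  have hquot : DifferentiableOn ℂ (fun x => g x / f x) (U ∩ {x | f x ≠ 0}) := by
    simp only [div_eq_mul_inv]
    exact (hg.mono Set.inter_subset_left).mul (hf.differentiableOn.inv fun x hx => hx.2)
  refine (differentiableAt_circleIntegral_mul_comp_add_smul
    (hU.inter (isOpen_ne_fun hf.continuous continuous_const)) hquot hr.le ?_
    hy).differentiableWithinAt
  exact ContinuousOn.inv₀ (by fun_prop) fun t ht => by
    simpa using ne_of_mem_of_not_mem ht (by simp [hr.ne])

theorem exists_local_quotient [FiniteDimensional ℂ E] (hU : IsOpen U) (hf : Differentiable ℂ f)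
    (hg : DifferentiableOn ℂ g U) (hvan : ∀ x ∈ U, f x = 0 → g x = 0) {v : E}
    {P : E → Polynomial ℂ} (hfP : ∀ y t, f (y + t • v) = (P y).eval t)
    (hdense : Dense {y | (P y).Separable}) {p : E} (hp : p ∈ U) (hPp : P p ≠ 0) :
    ∃ V, IsOpen V ∧ p ∈ V ∧ ∃ q : E → ℂ, DifferentiableOn ℂ q V ∧ ∀ y ∈ V, g y = q y * f y := by
  obtain ⟨ρ, hρ, hρU⟩ := exists_closedBall_add_smul_mem hU v hp
  obtain ⟨r, hr, hrρ, hpr⟩ := exists_radius_forall_sphere_eval_ne_zero hPp hρ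
  let V : Set E := {y | ∀ t ∈ Metric.closedBall (0 : ℂ) r, y + t • v ∈ U} ∩
    {y | ∀ t ∈ Metric.sphere (0 : ℂ) r, y + t • v ∈ U ∩ {x | f x ≠ 0}}
  have hV : IsOpen V := (isOpen_setOf_forall_add_smul_mem hU (isCompact_closedBall _ _) v).inter
    (isOpen_setOf_forall_add_smul_mem (hU.inter (isOpen_ne_fun hf.continuous continuous_const))
      (isCompact_sphere _ _) v)
  have hpV : p ∈ V := by
    have hpU : ∀ t ∈ Metric.closedBall (0 : ℂ) r, p + t • v ∈ U := fun t ht =>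
      hρU t (Metric.closedBall_subset_closedBall hrρ ht)
    refine ⟨hpU, fun t ht => ⟨hpU t (Metric.sphere_subset_closedBall ht), ?_⟩⟩
    rw [Set.mem_ofPred_eq, hfP]
    exact hpr t ht
  have hVU : V ⊆ U := fun y hy => by simpa using hy.1 0 (Metric.mem_closedBall_self hr.le)
  let q : E → ℂ := fun y => (2 * Real.pi * Complex.I)⁻¹ *
    ∮ t in C(0, r), (t - 0)⁻¹ * (g (y + t • v) / f (y + t • v))
  have hq : DifferentiableOn ℂ q V :=
    ((differentiableOn_circleIntegral_div_comp_add_smul hU hf hg hr v).mono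
      Set.inter_subset_right).const_mul _
  refine ⟨V, hV, hpV, q, hq, Set.EqOn.of_subset_closure (s := V ∩ {y | (P y).Separable}) ?_
    (hg.continuousOn.mono hVU) (hq.continuousOn.mul hf.continuous.continuousOn)
    Set.inter_subset_left (hdense.open_subset_closure_inter hV)⟩
  rintro y ⟨hy, hsep⟩
  have hcauchy := eq_circleIntegral_div_mul_eval (γ := fun t : ℂ => g (y + t • v))
    (hU.preimage (by fun_prop : Continuous fun t : ℂ => y + t • v))
    (hg.comp (by fun_prop) fun t ht => ht) hsep
    (fun t ht h0 => hvan _ ht ((hfP y t).trans h0)) hr hy.1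
    fun t ht => by rw [← hfP]; exact (hy.2 t ht).2
  simpa only [← hfP, zero_smul, add_zero] using hcauchy

theorem exists_quotient_of_local (hdense : Dense {x | f x ≠ 0})
    (hloc : ∀ p ∈ U, ∃ V, IsOpen V ∧ p ∈ V ∧
      ∃ q : E → ℂ, DifferentiableOn ℂ q V ∧ ∀ y ∈ V, g y = q y * f y) :
    ∃ q : E → ℂ, DifferentiableOn ℂ q U ∧ ∀ x ∈ U, g x = q x * f x := by
  choose! V hV hmem q hq hgq using hloc
  refine ⟨fun x => q x x, fun p hp => ?_, fun x hx => hgq x hx x (hmem x hx)⟩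
  have hqp := (hq p hp).differentiableAt ((hV p hp).mem_nhds (hmem p hp))
  refine hqp.differentiableWithinAt.congr_of_eventuallyEq ?_ rfl
  filter_upwards [self_mem_nhdsWithin,
    mem_nhdsWithin_of_mem_nhds ((hV p hp).mem_nhds (hmem p hp))] with y hyU hyp
  have heq : Set.EqOn (q y) (q p) (V y ∩ V p) := by
    refine Set.EqOn.of_subset_closure (s := (V y ∩ V p) ∩ {x | f x ≠ 0}) ?_
      ((hq y hyU).continuousOn.mono Set.inter_subset_left)
      ((hq p hp).continuousOn.mono Set.inter_subset_right) Set.inter_subset_left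
      (hdense.open_subset_closure_inter ((hV y hyU).inter (hV p hp)))
    rintro z ⟨⟨hzy, hzp⟩, hz⟩
    exact mul_right_cancel₀ hz ((hgq y hyU z hzy).symm.trans (hgq p hp z hzp))
  exact heq ⟨hmem y hyU, hyp⟩

end Division

/-! ### Squarefree polynomials on lines -/

section Localization

variable {R S : Type*} [CommRing R] [CommRing S] [Algebra R S] (M : Submonoid R)
  [IsLocalization M S]

theorem exists_dvd_mul_of_algebraMap_dvd_algebraMap {a b : R}
    (h : algebraMap R S a ∣ algebraMap R S b) : ∃ m ∈ M, a ∣ m * b := by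
  obtain ⟨z, hz⟩ := h
  obtain ⟨⟨c, s⟩, hc⟩ := IsLocalization.surj M z
  obtain ⟨t, ht⟩ := IsLocalization.exists_of_eq (M := M) (S := S) (x := s * b) (y := a * c)
    (by simp only [map_mul]; rw [← hc, hz]; ring)
  refine ⟨t * s, M.mul_mem t.2 s.2, t * c, ?_⟩
  rw [mul_assoc, ht]
  ring

include M in
theorem isRadical_algebraMap {a : R} (ha : IsRadical a) : IsRadical (algebraMap R S a) := by
  intro n x hx
  obtain ⟨⟨y, s⟩, hy⟩ := IsLocalization.surj M x
  have hdvd : algebraMap R S a ∣ algebraMap R S (y ^ n) := by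
    rw [map_pow, ← hy, mul_pow]
    exact hx.mul_right _
  obtain ⟨m, hm, hmy⟩ := exists_dvd_mul_of_algebraMap_dvd_algebraMap M hdvd
  have hmy' : a ∣ m * y := ha (n + 1) _ (hmy.trans ⟨m ^ n * y, by ring⟩)
  have hunit : IsUnit (algebraMap R S (m * s)) :=
    IsLocalization.map_units S (⟨m, hm⟩ * s : M)
  refine hunit.dvd_mul_right.mp ((map_dvd (algebraMap R S) hmy').trans (dvd_of_eq ?_))
  rw [map_mul, map_mul, ← hy]
  ring

end Localization

theorem exists_mul_add_mul_derivative_eq_C {A : Type*} [CommRing A] [IsDomain A] [CharZero A]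
    [UniqueFactorizationMonoid A] {P : Polynomial A} (hP : Squarefree P) :
    ∃ a b : Polynomial A, ∃ r ≠ 0, a * P + b * Polynomial.derivative P = Polynomial.C r := by
  let K := FractionRing A
  have hinj : Function.Injective (Polynomial.mapRingHom (algebraMap A K)) :=
    Polynomial.map_injective _ (IsFractionRing.injective A K)
  have hsep : (P.map (algebraMap A K)).Separable := by
    let := Polynomial.algebra A K
    have := Polynomial.isLocalization (nonZeroDivisors A) K
    rw [PerfectField.separable_iff_squarefree]
    exact (isRadical_algebraMap ((nonZeroDivisors A).map Polynomial.C) hP.isRadical).squarefree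
      ((map_ne_zero_iff _ hinj).mpr hP.ne_zero)
  obtain ⟨a, b, hab⟩ := hsep
  obtain ⟨s, hs, ha⟩ := IsLocalization.integerNormalization_spec (nonZeroDivisors A) a
  obtain ⟨t, ht, hb⟩ := IsLocalization.integerNormalization_spec (nonZeroDivisors A) b
  refine ⟨Polynomial.C t * IsLocalization.integerNormalization (nonZeroDivisors A) a,
    Polynomial.C s * IsLocalization.integerNormalization (nonZeroDivisors A) b, s * t,
    nonZeroDivisors.ne_zero (mul_mem hs ht), hinj ?_⟩
  simp only [map_add, map_mul, Polynomial.coe_mapRingHom, ha, hb, Polynomial.map_C,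
    ← Polynomial.derivative_map, Algebra.smul_def, Polynomial.algebraMap_apply]
  linear_combination (Polynomial.C (algebraMap A K s) * Polynomial.C (algebraMap A K t)) * hab

theorem squarefree_polynomial_C {A : Type*} [CommRing A] [IsDomain A] {a : A} (ha : Squarefree a) :
    Squarefree (Polynomial.C a) := by
  intro P hP
  have hdeg : P.natDegree = 0 := by
    have := Polynomial.natDegree_le_of_dvd hP (Polynomial.C_ne_zero.mpr ha.ne_zero)
    rw [Polynomial.natDegree_C, ← pow_two, Polynomial.natDegree_pow] at this
    lia
  rw [Polynomial.eq_C_of_natDegree_eq_zero hdeg, ← map_mul, Polynomial.C_dvd_iff_dvd_coeff] at hP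
  rw [Polynomial.eq_C_of_natDegree_eq_zero hdeg]
  exact (ha _ (by simpa using hP 0)).map Polynomial.C

section Lines

variable {ι : Type*}

theorem differentiable_eval [Finite ι] (F : MvPolynomial ι ℂ) :
    Differentiable ℂ fun x : ι → ℂ => MvPolynomial.eval x F := by
  have := Fintype.ofFinite ι
  induction F using MvPolynomial.induction_on with
  | C a => simp
  | add p q hp hq => simpa only [map_add] using hp.fun_add hq
  | mul_X p i hp =>
    simpa only [map_mul, MvPolynomial.eval_X] using hp.fun_mul (differentiable_apply i)

theorem dense_setOf_eval_ne_zero [Finite ι] {F : MvPolynomial ι ℂ} (hF : F ≠ 0) :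
    Dense {x | MvPolynomial.eval x F ≠ 0} := by
  obtain ⟨x₀, hx₀⟩ : ∃ x, MvPolynomial.eval x F ≠ 0 := by
    by_contra! h
    exact hF (MvPolynomial.funext fun x => by simpa using h x)
  have := Fintype.ofFinite ι
  exact dense_setOf_ne_zero_of_differentiable (differentiable_eval F) hx₀

theorem dense_setOf_map_eval_separable [Finite ι] {P : Polynomial (MvPolynomial ι ℂ)}
    (hP : Squarefree P) : Dense {y | (P.map (MvPolynomial.eval y)).Separable} := by
  obtain ⟨a, b, r, hr, hab⟩ := exists_mul_add_mul_derivative_eq_C hP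
  refine (dense_setOf_eval_ne_zero hr).mono fun y hy => ?_
  have heval := congrArg (Polynomial.map (MvPolynomial.eval y)) hab
  simp only [Polynomial.map_add, Polynomial.map_mul, ← Polynomial.derivative_map,
    Polynomial.map_C] at heval
  have hinv :
      Polynomial.C (MvPolynomial.eval y r)⁻¹ * Polynomial.C (MvPolynomial.eval y r) = 1 := by
    rw [← map_mul, inv_mul_cancel₀ hy, map_one]
  refine ⟨Polynomial.C (MvPolynomial.eval y r)⁻¹ * a.map (MvPolynomial.eval y),
    Polynomial.C (MvPolynomial.eval y r)⁻¹ * b.map (MvPolynomial.eval y), ?_⟩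
  linear_combination Polynomial.C (MvPolynomial.eval y r)⁻¹ * heval + hinv

/-- The substitution `xᵢ ↦ xᵢ + vᵢ t` in the polynomials in `t` with coefficients in `ℂ[x]`. It
turns a constant polynomial `F` into the restriction of `F` to the lines with direction `v`. -/
noncomputable def lineShift (v : ι → ℂ) :
    Polynomial (MvPolynomial ι ℂ) →+* Polynomial (MvPolynomial ι ℂ) :=
  Polynomial.eval₂RingHom (MvPolynomial.eval₂Hom (Polynomial.C.comp MvPolynomial.C) fun i =>
    Polynomial.C (MvPolynomial.X i) + Polynomial.C (MvPolynomial.C (v i)) * Polynomial.X)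
    Polynomial.X

theorem lineShift_X (v : ι → ℂ) : lineShift v Polynomial.X = Polynomial.X := by
  simp [lineShift]

theorem lineShift_C_X (v : ι → ℂ) (i : ι) : lineShift v (Polynomial.C (MvPolynomial.X i)) =
    Polynomial.C (MvPolynomial.X i) + Polynomial.C (MvPolynomial.C (v i)) * Polynomial.X := by
  simp [lineShift]

theorem lineShift_C_C (v : ι → ℂ) (a : ℂ) : lineShift v (Polynomial.C (MvPolynomial.C a)) =
    Polynomial.C (MvPolynomial.C a) := by
  simp [lineShift]

theorem lineShift_neg_lineShift (v : ι → ℂ) (P : Polynomial (MvPolynomial ι ℂ)) :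
    lineShift (-v) (lineShift v P) = P := by
  suffices h : (lineShift (-v)).comp (lineShift v) = RingHom.id _ from RingHom.congr_fun h P
  refine Polynomial.ringHom_ext' (MvPolynomial.ringHom_ext (fun a => ?_) fun i => ?_) ?_
  · simp [lineShift_C_C]
  · simp only [RingHom.comp_apply, RingHom.id_apply, lineShift_C_X, lineShift_C_C, lineShift_X,
      map_add, map_mul, map_neg, Pi.neg_apply]
    ring
  · simp [lineShift_X]

theorem squarefree_lineShift (v : ι → ℂ) {P : Polynomial (MvPolynomial ι ℂ)} (hP : Squarefree P) :
    Squarefree (lineShift v P) := by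
  intro Q hQ
  have hunit : IsUnit (lineShift (-v) Q) := hP _ (by
    simpa only [map_mul, lineShift_neg_lineShift] using map_dvd (lineShift (-v)) hQ)
  have hQ' : lineShift v (lineShift (-v) Q) = Q := by
    simpa only [neg_neg] using lineShift_neg_lineShift (-v) Q
  exact hQ' ▸ hunit.map (lineShift v)

theorem eval_map_lineShift (v y : ι → ℂ) (t : ℂ) (F : MvPolynomial ι ℂ) :
    ((lineShift v (Polynomial.C F)).map (MvPolynomial.eval y)).eval t =
      MvPolynomial.eval (y + t • v) F := by
  induction F using MvPolynomial.induction_on with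
  | C a => simp [lineShift_C_C]
  | add p q hp hq => simp only [map_add, Polynomial.map_add, Polynomial.eval_add, hp, hq]
  | mul_X p i hp =>
    simp only [map_mul, Polynomial.map_mul, Polynomial.eval_mul, hp, lineShift_C_X]
    simp [mul_comm t]

end Lines

theorem isReducedEquation_of_squarefree {ι : Type*} [Fintype ι] {F : MvPolynomial ι ℂ}
    (hF : Squarefree F) :
    IsReducedEquation (fun x => MvPolynomial.eval x F) {x | MvPolynomial.eval x F = 0} := by
  have hdense := dense_setOf_eval_ne_zero hF.ne_zero
  obtain ⟨x₀, hx₀⟩ := hdense.nonempty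
  refine ⟨differentiable_eval F, fun h => hx₀ (h ▸ Set.mem_univ x₀ :), rfl,
    fun U g hU hg hvan => exists_quotient_of_local hdense fun p hp => ?_⟩
  refine exists_local_quotient hU (differentiable_eval F) hg hvan
    (fun y t => (eval_map_lineShift (x₀ - p) y t F).symm)
    (dense_setOf_map_eval_separable (squarefree_lineShift _ (squarefree_polynomial_C hF)))
    hp fun h => ?_
  refine hx₀ ?_
  have heval := eval_map_lineShift (x₀ - p) p 1 F
  rw [h, Polynomial.eval_zero, one_smul, add_sub_cancel] at heval
  exact heval.symm

/-! ### Logarithmic vector fields and Saito's criterion -/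

theorem eventuallyEq_zero_of_deriv_eventuallyEq_mul {φ q : ℂ → ℂ} {z : ℂ}
    (hφ : AnalyticAt ℂ φ z) (hq : AnalyticAt ℂ q z) (hz : φ z = 0)
    (h : deriv φ =ᶠ[nhds z] q * φ) : φ =ᶠ[nhds z] 0 := by
  have horder := hφ.analyticOrderAt_deriv_add_one
  simp only [hz, sub_zero] at horder
  rw [analyticOrderAt_congr h, analyticOrderAt_mul hq hφ] at horder
  refine analyticOrderAt_eq_top.mp (by_contra fun hfin => ?_)
  lift analyticOrderAt φ z to ℕ using hfin with k
  cases hqo : analyticOrderAt q z with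
  | top => simp [hqo] at horder
  | coe l =>
    rw [hqo] at horder
    norm_cast at horder
    lia

theorem det_eq_zero_of_forall_col_mem_ker {ι : Type*} [Fintype ι] [DecidableEq ι]
    {K : Type*} [Field K] {φ : (ι → K) →ₗ[K] K} (hφ : φ ≠ 0) {N : Matrix ι ι K}
    (hN : ∀ k, φ (fun i => N i k) = 0) : N.det = 0 := by
  by_contra hdet
  refine hφ (LinearMap.ext fun v => ?_)
  obtain ⟨w, rfl⟩ := (Matrix.mulVec_surjective_iff_isUnit.mpr
    (N.isUnit_iff_isUnit_det.mpr (Ne.isUnit hdet))) v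
  have hsum : φ (N *ᵥ w) = ∑ k, w k • φ (fun i => N i k) := by
    simp only [Matrix.mulVec_eq_sum, op_smul_eq_smul, map_sum, map_smul]
    rfl
  simp only [hsum, hN, smul_zero, Finset.sum_const_zero, LinearMap.zero_apply]

theorem differentiableOn_det {ι E : Type*} [Fintype ι] [DecidableEq ι] [NormedAddCommGroup E]
    [NormedSpace ℂ E] {U : Set E} {N : E → Matrix ι ι ℂ}
    (hN : ∀ i k, DifferentiableOn ℂ (fun y => N y i k) U) :
    DifferentiableOn ℂ (fun y => (N y).det) U := by
  have heval : ∀ M : Matrix ι ι ℂ, M.det =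
      MvPolynomial.eval (fun q => M q.1 q.2) (Matrix.mvPolynomialX ι ι ℂ).det := fun M => by
    rw [RingHom.map_det, Matrix.mvPolynomialX_mapMatrix_eval]
  simp only [heval]
  exact Differentiable.comp_differentiableOn (f := fun y (q : ι × ι) => N y q.1 q.2)
    (differentiable_eval (Matrix.mvPolynomialX ι ι ℂ).det)
    (differentiableOn_pi.mpr fun q => hN q.1 q.2)

section LogVectorFields

variable {ι : Type*} [Fintype ι] {f : (ι → ℂ) → ℂ} {D U : Set (ι → ℂ)}

theorem IsReducedEquation.mem_iff (hf : IsReducedEquation f D) {x : ι → ℂ} : x ∈ D ↔ f x = 0 := by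
  rw [hf.2.2.1, Set.mem_ofPred_eq]

theorem IsReducedEquation.dense_ne_zero (hf : IsReducedEquation f D) : Dense {x | f x ≠ 0} := by
  obtain ⟨x₀, hx₀⟩ := (Set.ne_univ_iff_exists_notMem D).mp hf.2.1
  exact dense_setOf_ne_zero_of_differentiable hf.1 (mt hf.mem_iff.mpr hx₀)

theorem IsReducedEquation.const_mul (hf : IsReducedEquation f D) {c : ℂ} (hc : c ≠ 0) :
    IsReducedEquation (fun x => c * f x) D := by
  refine ⟨hf.1.const_mul c, hf.2.1, ?_, fun U g hU hg hvan => ?_⟩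
  · simp only [mul_eq_zero, hc, false_or, ← hf.2.2.1]
  · obtain ⟨q, hqd, hq⟩ := hf.2.2.2 U g hU hg hvan
    refine ⟨fun x => q x * c⁻¹, hqd.mul_const _, fun x hx => ?_⟩
    rw [hq x hx]
    field_simp

/- If `df` vanished on all of `D` near `p`, then the derivative of `f` along any line through `p`
would be a multiple of `f`, and so `f` would vanish along all these lines. -/
theorem IsReducedEquation.exists_fderiv_ne_zero (hf : IsReducedEquation f D) (hU : IsOpen U)
    {p : ι → ℂ} (hpU : p ∈ U) (hpD : p ∈ D) : ∃ y ∈ U, y ∈ D ∧ fderiv ℂ f y ≠ 0 := by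
  by_contra! hsing
  obtain ⟨x₀, hx₀⟩ := hf.dense_ne_zero.nonempty
  let γ : ℂ → ι → ℂ := fun t => p + t • (x₀ - p)
  have hγ : ∀ t, HasDerivAt γ (x₀ - p) t := fun t => by
    simpa only [one_smul, id] using ((hasDerivAt_id t).smul_const (x₀ - p)).const_add p
  have hγ0 : γ 0 = p := by simp [γ]
  obtain ⟨q, hqd, hq⟩ := hf.2.2.2 U _ hU
    (differentiableOn_fderiv_apply hU hf.1.differentiableOn (x₀ - p)) fun y hyU hyD => by
      rw [hsing y hyU hyD, _root_.zero_apply]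
  have hγU : IsOpen (γ ⁻¹' U) := hU.preimage (by fun_prop)
  have h0U : γ ⁻¹' U ∈ nhds 0 := hγU.mem_nhds (by rwa [Set.mem_preimage, hγ0])
  have hfγ : Differentiable ℂ (f ∘ γ) := fun t =>
    (hf.1 _).comp t (hγ t).differentiableAt
  have hqγ : DifferentiableOn ℂ (q ∘ γ) (γ ⁻¹' U) :=
    hqd.comp (fun t _ => (hγ t).differentiableAt.differentiableWithinAt) fun t ht => ht
  have hzero := eventuallyEq_zero_of_deriv_eventuallyEq_mul (hfγ.analyticAt 0)
    (hqγ.analyticAt h0U) (by rw [Function.comp_apply, hγ0, hf.mem_iff.mp hpD])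
    (Filter.mem_of_superset h0U fun t ht => by
      simpa [((hf.1 _).hasFDerivAt.comp_hasDerivAt t (hγ t)).deriv] using hq _ ht)
  have hglobal := AnalyticOnNhd.eq_of_eventuallyEq (fun t _ => hfγ.analyticAt t)
    analyticOnNhd_const hzero
  have hx₀' := congrFun hglobal 1
  rw [Function.comp_apply, show γ 1 = x₀ by simp [γ]] at hx₀'
  exact hx₀ hx₀'

theorem IsLogBasis.reindex {κ κ' : Type*} [Fintype κ] [Fintype κ'] {δ : κ → (ι → ℂ) → ι → ℂ}
    (h : IsLogBasis f U δ) (e : κ' ≃ κ) : IsLogBasis f U (fun k => δ (e k)) := by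
  obtain ⟨hlog, hspan, hindep⟩ := h
  refine ⟨fun k => hlog (e k), fun η hη => ?_, fun c hc hsum k x hx => ?_⟩
  · obtain ⟨c, hc, hsum⟩ := hspan η hη
    refine ⟨fun k => c (e k), fun k => hc (e k), fun x hx => ?_⟩
    rw [hsum x hx, e.sum_comp fun k => c k x • δ k x]
  · have h0 := hindep (fun k => c (e.symm k)) (fun k => hc _) (fun x hx => by
      rw [← hsum x hx, ← e.sum_comp]
      simp only [e.symm_apply_apply]) (e k) x hx
    simpa only [e.symm_apply_apply] using h0

/-- The Saito matrix of a family of vector fields: its columns are the values of the fields. Its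
determinant decides whether the fields form a basis of the logarithmic vector fields. -/
def saitoMatrix {ι : Type*} (δ : ι → (ι → ℂ) → ι → ℂ) (x : ι → ℂ) : Matrix ι ι ℂ :=
  Matrix.of fun i k => δ k x i

theorem saitoMatrix_update {ι : Type*} [DecidableEq ι] (δ : ι → (ι → ℂ) → ι → ℂ) (k : ι)
    (η : (ι → ℂ) → ι → ℂ) (x : ι → ℂ) :
    saitoMatrix (Function.update δ k η) x = (saitoMatrix δ x).updateCol k (η x) := by
  ext i j
  rcases eq_or_ne j k with rfl | hjk <;> simp [saitoMatrix, *]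

variable {δ : ι → (ι → ℂ) → ι → ℂ}

theorem saitoMatrix_mulVec (x h : ι → ℂ) : saitoMatrix δ x *ᵥ h = ∑ k, h k • δ k x := by
  funext i
  simp [saitoMatrix, Matrix.mulVec, dotProduct, mul_comm]

variable [DecidableEq ι]

theorem differentiableOn_det_saitoMatrix (hδ : ∀ k, DifferentiableOn ℂ (δ k) U) :
    DifferentiableOn ℂ (fun x => (saitoMatrix δ x).det) U :=
  differentiableOn_det fun i k => differentiableOn_pi.mp (hδ k) i

theorem IsReducedEquation.det_saitoMatrix_eq_zero (hf : IsReducedEquation f D) (hU : IsOpen U)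
    (hδ : ∀ k, IsLogVectorField f U (δ k)) {x : ι → ℂ} (hxU : x ∈ U) (hxD : x ∈ D) :
    (saitoMatrix δ x).det = 0 := by
  by_contra hne
  obtain ⟨y, ⟨hyU, hy⟩, hyD, hdf⟩ := hf.exists_fderiv_ne_zero
    ((differentiableOn_det_saitoMatrix fun k => (hδ k).1).continuousOn.isOpen_inter_preimage hU
      isOpen_ne) ⟨hxU, hne⟩ hxD
  refine hy (det_eq_zero_of_forall_col_mem_ker (φ := (fderiv ℂ f y).toLinearMap)
    (fun h => hdf (ContinuousLinearMap.coe_injective h)) fun k => ?_)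
  obtain ⟨-, q, -, hq⟩ := hδ k
  exact (hq y hyU).trans (by rw [hf.mem_iff.mp hyD, mul_zero])

theorem IsReducedEquation.exists_det_saitoMatrix_eq (hf : IsReducedEquation f D) (hU : IsOpen U)
    (hδ : ∀ k, IsLogVectorField f U (δ k)) :
    ∃ q : (ι → ℂ) → ℂ, DifferentiableOn ℂ q U ∧ ∀ x ∈ U, (saitoMatrix δ x).det = q x * f x :=
  hf.2.2.2 U _ hU (differentiableOn_det_saitoMatrix fun k => (hδ k).1) fun _ hxU hxD =>
    hf.det_saitoMatrix_eq_zero hU hδ hxU hxD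

theorem IsReducedEquation.isLogBasis_of_det_saitoMatrix_eq (hf : IsReducedEquation f D)
    (hU : IsOpen U) (hδ : ∀ k, IsLogVectorField f U (δ k)) {u : (ι → ℂ) → ℂ}
    (hu : DifferentiableOn ℂ u U) (hu0 : ∀ x ∈ U, u x ≠ 0)
    (hdet : ∀ x ∈ U, (saitoMatrix δ x).det = u x * f x) : IsLogBasis f U δ := by
  have hclosure : U ⊆ closure (U ∩ {x | f x ≠ 0}) := hf.dense_ne_zero.open_subset_closure_inter hU
  refine ⟨hδ, fun η hη => ?_, fun h hh hsum k => ?_⟩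
  · have hlog : ∀ k j, IsLogVectorField f U (Function.update δ k η j) := fun k j => by
      rcases eq_or_ne j k with rfl | hjk <;> simp [*]
    choose q hqd hq using fun k => hf.exists_det_saitoMatrix_eq hU (hlog k)
    have hcoeff : ∀ k, DifferentiableOn ℂ (fun x => (u x)⁻¹ * q k x) U := fun k =>
      (hu.inv hu0).mul (hqd k)
    refine ⟨fun k x => (u x)⁻¹ * q k x, hcoeff, Set.EqOn.of_subset_closure ?_ hη.1.continuousOn
      (continuousOn_finsetSum _ fun k _ => (hcoeff k).continuousOn.smul (hδ k).1.continuousOn)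
      Set.inter_subset_left hclosure⟩
    rintro x ⟨hx, hfx⟩
    have hcramer : (saitoMatrix δ x).cramer (η x) = f x • fun k => q k x := by
      funext k
      rw [Matrix.cramer_apply, ← saitoMatrix_update, hq k x hx, Pi.smul_apply, smul_eq_mul,
        mul_comm]
    have hsol := (saitoMatrix δ x).mulVec_cramer (η x)
    rw [hcramer, Matrix.mulVec_smul, saitoMatrix_mulVec, hdet x hx, mul_comm, mul_smul] at hsol
    simp only [mul_smul, ← Finset.smul_sum]
    rw [smul_right_injective _ hfx hsol, inv_smul_smul₀ (hu0 x hx)]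
  · refine Set.EqOn.of_subset_closure ?_ (hh k).continuousOn continuousOn_const
      Set.inter_subset_left hclosure
    rintro x ⟨hx, hfx⟩
    refine congrFun (Matrix.eq_zero_of_mulVec_eq_zero (M := saitoMatrix δ x) (v := fun k => h k x)
      ?_ ?_) k
    · rw [hdet x hx]
      exact mul_ne_zero (hu0 x hx) hfx
    · rw [saitoMatrix_mulVec, hsum x hx]

end LogVectorFields

/-! ### Semi-invariants and the discriminant determinant -/

theorem eq_zero_pow_mul_of_homogeneous {E : Type*} [NormedAddCommGroup E] [NormedSpace ℂ E]
    {f g q : E → ℂ} {N k : ℕ} (hq : ContinuousAt q 0)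
    (hf : ∀ (t : ℂ) x, f (t • x) = t ^ (N + k) * f x)
    (hg : ∀ (t : ℂ) x, g (t • x) = t ^ N * g x) (h : ∀ x, g x = q x * f x) (x : E) :
    g x = 0 ^ k * (q 0 * f x) := by
  have hqx : ContinuousAt (fun t : ℂ => q (t • x)) 0 :=
    ContinuousAt.comp_of_eq hq (by fun_prop) (zero_smul ℂ x)
  have hcont : ContinuousAt (fun t : ℂ => t ^ k * (q (t • x) * f x)) 0 :=
    (continuousAt_id.pow k).mul (hqx.mul continuousAt_const)
  have hlim := hcont.tendsto.mono_left (nhdsWithin_le_nhds (s := {0}ᶜ))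
  simp only [zero_smul] at hlim
  refine tendsto_nhds_unique (tendsto_const_nhds.congr' ?_) hlim
  filter_upwards [self_mem_nhdsWithin] with t ht
  have heq := h (t • x)
  rw [hg, hf, pow_add] at heq
  refine mul_left_cancel₀ (pow_ne_zero N ht) ?_
  linear_combination heq

theorem fderiv_eval_apply {ι : Type*} [Fintype ι] (p : MvPolynomial ι ℂ) (x v : ι → ℂ) :
    fderiv ℂ (fun x => MvPolynomial.eval x p) x v =
      ∑ q, MvPolynomial.eval x (MvPolynomial.pderiv q p) * v q := by
  classical
  induction p using MvPolynomial.induction_on with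
  | C a => simp
  | add p q hp hq =>
    simp only [map_add, add_mul, Finset.sum_add_distrib, ← hp, ← hq]
    rw [fderiv_fun_add (differentiable_eval p x) (differentiable_eval q x)]
    rfl
  | mul_X p i hp =>
    simp only [map_mul, MvPolynomial.eval_X]
    rw [fderiv_fun_mul (differentiable_eval p x) (differentiableAt_apply i x)]
    simp [hp, MvPolynomial.pderiv_X, Pi.single_apply, apply_ite, add_mul, Finset.sum_add_distrib,
      Finset.mul_sum, mul_assoc, fderiv_apply]

/-- For a polynomial `F` on `ι → ℂ` and a point `x`, the polynomial `g ↦ F (g x)` in the entries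
of a matrix `g`. It transports information about `F` along a group to its Lie algebra. -/
noncomputable def orbitPolynomial {ι : Type*} [Fintype ι] (F : MvPolynomial ι ℂ) (x : ι → ℂ) :
    MvPolynomial (ι × ι) ℂ :=
  MvPolynomial.bind₁ (fun i => ∑ j, MvPolynomial.C (x j) * MvPolynomial.X (i, j)) F

theorem eval_orbitPolynomial {ι : Type*} [Fintype ι] (F : MvPolynomial ι ℂ) (x : ι → ℂ)
    (M : Matrix ι ι ℂ) :
    MvPolynomial.eval (fun q => M q.1 q.2) (orbitPolynomial F x) =
      MvPolynomial.eval (M *ᵥ x) F := by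
  rw [orbitPolynomial, MvPolynomial.eval, MvPolynomial.eval₂Hom_bind₁]
  congr 2
  funext i
  simp [Matrix.mulVec, dotProduct, mul_comm]

section LieAlgebra

variable {ι : Type*} [Fintype ι] [DecidableEq ι] {H : Subgroup (GL ι ℂ)} {X : Matrix ι ι ℂ}

theorem mem_lieAlgebraOf_iff : X ∈ lieAlgebraOf H ↔ ∀ p : MvPolynomial (ι × ι) ℂ,
    (∀ g ∈ H, MvPolynomial.eval (fun q => (g : Matrix ι ι ℂ) q.1 q.2) p = 0) →
      fderiv ℂ (fun y => MvPolynomial.eval y p) (fun q => (1 : Matrix ι ι ℂ) q.1 q.2)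
        (fun q => X q.1 q.2) = 0 := by
  simp only [fderiv_eval_apply]
  rfl

theorem mem_lieAlgebraOf_of_hasDerivAt {c : ℂ → Matrix ι ι ℂ} (hc1 : c 0 = 1)
    (hc : ∀ i j, HasDerivAt (fun t => c t i j) (X i j) 0)
    (hcH : ∀ᶠ t in nhds 0, ∃ g ∈ H, (g : Matrix ι ι ℂ) = c t) : X ∈ lieAlgebraOf H := by
  refine mem_lieAlgebraOf_iff.mpr fun p hp => ?_
  have hcurve : HasDerivAt (fun t (q : ι × ι) => c t q.1 q.2) (fun q => X q.1 q.2) 0 :=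
    hasDerivAt_pi.mpr fun q => hc q.1 q.2
  have hderiv := (differentiable_eval p _).hasFDerivAt.comp_hasDerivAt 0 hcurve
  rw [hc1] at hderiv
  refine hderiv.unique ((hasDerivAt_const (0 : ℂ) (0 : ℂ)).congr_of_eventuallyEq ?_)
  filter_upwards [hcH] with t ⟨g, hg, hgt⟩
  rw [Function.comp_apply, ← hgt]
  exact hp g hg

theorem fderiv_orbitPolynomial (F : MvPolynomial ι ℂ) (x : ι → ℂ) (X : Matrix ι ι ℂ) :
    fderiv ℂ (fun y => MvPolynomial.eval y (orbitPolynomial F x))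
        (fun q => (1 : Matrix ι ι ℂ) q.1 q.2) (fun q => X q.1 q.2) =
      fderiv ℂ (fun y => MvPolynomial.eval y F) x (X *ᵥ x) := by
  rw [← (differentiable_eval _ _).lineDeriv_eq_fderiv,
    ← (differentiable_eval _ _).lineDeriv_eq_fderiv]
  refine congrArg (deriv · 0) (funext fun t => (eval_orbitPolynomial F x (1 + t • X)).trans ?_)
  rw [Matrix.add_mulVec, Matrix.one_mulVec, Matrix.smul_mulVec]

end LieAlgebra

section SemiInvariant

variable {ι : Type*} [Fintype ι]

theorem differentiable_mulVec (M : Matrix ι ι ℂ) : Differentiable ℂ fun x => M *ᵥ x :=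
  M.mulVecLin.toContinuousLinearMap.differentiable

variable {F : MvPolynomial ι ℂ} {D : Set (ι → ℂ)} {d : ℕ}
  (hD : IsReducedEquation (fun x => MvPolynomial.eval x F) D)
  (hF : ∀ (t : ℂ) x, MvPolynomial.eval (t • x) F = t ^ d * MvPolynomial.eval x F)

include hD hF

theorem exists_eval_mulVec_eq {M : Matrix ι ι ℂ} (hM : ∀ x ∈ D, M *ᵥ x ∈ D) :
    ∃ χ, ∀ x, MvPolynomial.eval (M *ᵥ x) F = χ * MvPolynomial.eval x F := by
  obtain ⟨q, hqd, hq⟩ := hD.2.2.2 Set.univ (fun x => MvPolynomial.eval (M *ᵥ x) F) isOpen_univ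
    ((differentiable_eval F).comp (differentiable_mulVec M)).differentiableOn
    fun x _ hx => hD.mem_iff.mp (hM x hx)
  refine ⟨q 0, fun x => ?_⟩
  have h := eq_zero_pow_mul_of_homogeneous (N := d) (k := 0)
    (hqd.differentiableAt Filter.univ_mem).continuousAt hF
    (fun t x => by rw [Matrix.mulVec_smul, hF]) (fun x => hq x trivial) x
  rwa [pow_zero, one_mul] at h

variable [DecidableEq ι] {H : Subgroup (GL ι ℂ)} {X : Matrix ι ι ℂ}

theorem exists_fderiv_mulVec_eq_of_mem_lieAlgebraOf
    (hH : ∀ g ∈ H, ∀ x ∈ D, (g : Matrix ι ι ℂ) *ᵥ x ∈ D) (hX : X ∈ lieAlgebraOf H) :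
    ∃ c, ∀ x, fderiv ℂ (fun y => MvPolynomial.eval y F) x (X *ᵥ x) = c * MvPolynomial.eval x F := by
  obtain ⟨y, hy⟩ := hD.dense_ne_zero.nonempty
  refine ⟨fderiv ℂ (fun y => MvPolynomial.eval y F) y (X *ᵥ y) / MvPolynomial.eval y F,
    fun x => ?_⟩
  have hvan := mem_lieAlgebraOf_iff.mp hX (MvPolynomial.eval y F • orbitPolynomial F x -
    MvPolynomial.eval x F • orbitPolynomial F y) fun g hg => by
      obtain ⟨χ, hχ⟩ := exists_eval_mulVec_eq hD hF (hH g hg)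
      simp only [map_sub, MvPolynomial.smul_eval, eval_orbitPolynomial, hχ]
      ring
  rw [fderiv_eval_apply] at hvan
  simp only [map_sub, Derivation.map_smul, MvPolynomial.smul_eval, sub_mul, mul_assoc,
    Finset.sum_sub_distrib, ← Finset.mul_sum] at hvan
  simp only [← fderiv_eval_apply, fderiv_orbitPolynomial] at hvan
  rw [div_mul_eq_mul_div, eq_div_iff hy]
  linear_combination hvan

theorem isLogVectorField_of_mem_lieAlgebraOf
    (hH : ∀ g ∈ H, ∀ x ∈ D, (g : Matrix ι ι ℂ) *ᵥ x ∈ D) (hX : X ∈ lieAlgebraOf H)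
    (U : Set (ι → ℂ)) :
    IsLogVectorField (fun x => MvPolynomial.eval x F) U fun x => X *ᵥ x := by
  obtain ⟨c, hc⟩ := exists_fderiv_mulVec_eq_of_mem_lieAlgebraOf hD hF hH hX
  exact ⟨(differentiable_mulVec X).differentiableOn, fun _ => c, differentiableOn_const c,
    fun x _ => hc x⟩

end SemiInvariant

section Discriminant

variable {ι : Type*} [Fintype ι] [DecidableEq ι]

theorem eval_discriminantDet {L : Submodule ℂ (Matrix ι ι ℂ)} (A : Module.Basis ι ℂ L)
    (x : ι → ℂ) : MvPolynomial.eval x (discriminantDet A) =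
      (saitoMatrix (fun k x => (A k : Matrix ι ι ℂ) *ᵥ x) x).det := by
  rw [discriminantDet, RingHom.map_det]
  congr 1
  ext i k
  simp [saitoMatrix, Matrix.mulVec, dotProduct]

theorem eval_smul_discriminantDet {L : Submodule ℂ (Matrix ι ι ℂ)} (A : Module.Basis ι ℂ L)
    (t : ℂ) (x : ι → ℂ) : MvPolynomial.eval (t • x) (discriminantDet A) =
      t ^ Fintype.card ι * MvPolynomial.eval x (discriminantDet A) := by
  rw [eval_discriminantDet, eval_discriminantDet, ← Matrix.det_smul]
  congr 1
  ext i k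
  simp [saitoMatrix, Matrix.mulVec_smul]

variable {H : Subgroup (GL ι ℂ)} {F : MvPolynomial ι ℂ} {D : Set (ι → ℂ)}
  (A : Module.Basis ι ℂ (lieAlgebraOf H))
  (hD : IsReducedEquation (fun x => MvPolynomial.eval x F) D)
  (hH : ∀ g ∈ H, ∀ x ∈ D, (g : Matrix ι ι ℂ) *ᵥ x ∈ D)

include hD hH

theorem exists_eval_discriminantDet_eq {k : ℕ}
    (hF : ∀ (t : ℂ) x, MvPolynomial.eval (t • x) F =
      t ^ (Fintype.card ι + k) * MvPolynomial.eval x F) :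
    ∃ c, ∀ x, MvPolynomial.eval x (discriminantDet A) = 0 ^ k * (c * MvPolynomial.eval x F) := by
  obtain ⟨q, hqd, hq⟩ := hD.exists_det_saitoMatrix_eq isOpen_univ fun j =>
    isLogVectorField_of_mem_lieAlgebraOf hD hF hH (A j).2 Set.univ
  refine ⟨q 0, eq_zero_pow_mul_of_homogeneous (hqd.differentiableAt Filter.univ_mem).continuousAt
    hF (eval_smul_discriminantDet A) fun x => ?_⟩
  rw [eval_discriminantDet, hq x trivial]

theorem discriminantDet_eq_zero_of_card_lt {d : ℕ}
    (hF : ∀ (t : ℂ) x, MvPolynomial.eval (t • x) F = t ^ d * MvPolynomial.eval x F)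
    (hd : Fintype.card ι < d) : discriminantDet A = 0 := by
  obtain ⟨k, rfl⟩ := Nat.exists_eq_add_of_lt hd
  obtain ⟨c, hc⟩ := exists_eval_discriminantDet_eq (k := k + 1) A hD hH hF
  exact MvPolynomial.funext fun x => by simp [hc]

variable (hF : ∀ (t : ℂ) x, MvPolynomial.eval (t • x) F =
    t ^ Fintype.card ι * MvPolynomial.eval x F) (hΔ : discriminantDet A ≠ 0)

include hF hΔ

theorem isReducedEquation_discriminantDet :
    IsReducedEquation (fun x => MvPolynomial.eval x (discriminantDet A)) D := by
  obtain ⟨c, hc⟩ := exists_eval_discriminantDet_eq (k := 0) A hD hH hF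
  simp only [pow_zero, one_mul] at hc
  have hc0 : c ≠ 0 := by
    rintro rfl
    exact hΔ (MvPolynomial.funext fun x => by simp [hc])
  simpa only [hc] using hD.const_mul hc0

theorem isLinearFreeDivisor_of_discriminantDet_ne_zero : IsLinearFreeDivisor D := by
  have hΔD := isReducedEquation_discriminantDet A hD hH hF hΔ
  have hbasis : ∀ U, IsOpen U → IsLogBasis (fun x => MvPolynomial.eval x (discriminantDet A)) U
      fun k x => (A k : Matrix ι ι ℂ) *ᵥ x := fun U hU =>
    hΔD.isLogBasis_of_det_saitoMatrix_eq hU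
      (fun k => isLogVectorField_of_mem_lieAlgebraOf hΔD (eval_smul_discriminantDet A) hH (A k).2 U)
      (differentiableOn_const 1) (fun _ _ => one_ne_zero) fun x _ => by
        rw [one_mul, eval_discriminantDet]
  exact ⟨_, hΔD, fun p => ⟨Set.univ, isOpen_univ, trivial, Fintype.card ι, _,
    fun V hV _ => (hbasis V hV).reindex (Fintype.equivFin ι).symm⟩, _, hbasis _ isOpen_univ⟩

end Discriminant

/-! ### Minors of the generic matrix -/

section MinorPolynomial

variable {μ ν κ S : Type*} [Fintype κ] [DecidableEq κ] [CommRing S]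

/-- The minor with rows `r` and columns `c` of the generic matrix, as a polynomial in the entries
of this matrix. -/
noncomputable def minorPolynomial (S : Type*) [CommRing S] (r : κ → μ) (c : κ → ν) :
    MvPolynomial (μ × ν) S :=
  ((Matrix.mvPolynomialX μ ν S).submatrix r c).det

theorem eval_minorPolynomial (r : κ → μ) (c : κ → ν) (x : μ × ν → S) :
    MvPolynomial.eval x (minorPolynomial S r c) = (Matrix.of fun i j => x (r i, c j)).det := by
  rw [minorPolynomial, RingHom.map_det]
  congr 1
  ext i j
  simp

theorem eval_smul_minorPolynomial (r : κ → μ) (c : κ → ν) (t : S) (x : μ × ν → S) :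
    MvPolynomial.eval (t • x) (minorPolynomial S r c) =
      t ^ Fintype.card κ * MvPolynomial.eval x (minorPolynomial S r c) := by
  rw [eval_minorPolynomial, eval_minorPolynomial, ← Matrix.det_smul]
  rfl

theorem eval_extend_minorPolynomial {r : κ → μ} {c : κ → ν} (hr : r.Injective) (hc : c.Injective)
    (N : Matrix κ κ S) (x : μ × ν → S) :
    MvPolynomial.eval (Function.extend (Prod.map r c) (Function.uncurry N) x)
      (minorPolynomial S r c) = N.det := by
  rw [eval_minorPolynomial]
  congr 1
  ext i j
  exact (hr.prodMap hc).extend_apply _ x (i, j)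

theorem minorPolynomial_mem_supported {r : κ → μ} {c : κ → ν} {s : Set (μ × ν)}
    (h : ∀ i j, (r i, c j) ∈ s) : minorPolynomial S r c ∈ MvPolynomial.supported S s := by
  rw [minorPolynomial, Matrix.det_apply]
  refine sum_mem fun σ _ => zsmul_mem (Subalgebra.prod_mem _ fun i _ => ?_) _
  exact Algebra.subset_adjoin ⟨_, h (σ i) i, rfl⟩

theorem minorPolynomial_succ {k : ℕ} (r : Fin (k + 1) → μ) (c : Fin (k + 1) → ν) :
    minorPolynomial S r c = minorPolynomial S (r ∘ Fin.succ) (c ∘ Fin.succ) *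
      MvPolynomial.X (r 0, c 0) + ∑ j : Fin k, (-1) ^ (j.succ : ℕ) *
        MvPolynomial.X (r 0, c j.succ) *
          minorPolynomial S (r ∘ Fin.succ) (c ∘ j.succ.succAbove) := by
  rw [minorPolynomial, Matrix.det_succ_row_zero, Fin.sum_univ_succ]
  simp [minorPolynomial, Matrix.submatrix_submatrix, mul_comm]

theorem not_minorPolynomial_succ_dvd [Nontrivial S] {k : ℕ} {r : Fin (k + 2) → μ}
    {c : Fin (k + 2) → ν} (hr : r.Injective) (hc : c.Injective) :
    ¬ minorPolynomial S (r ∘ Fin.succ) (c ∘ Fin.succ) ∣ minorPolynomial S r c := by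
  intro hdvd
  -- At the transposition matrix of `0` and `1` the smaller minor has a zero row.
  let P : Matrix (Fin (k + 2)) (Fin (k + 2)) S := (Equiv.swap 0 1).permMatrix S
  have h := map_dvd (MvPolynomial.eval (Function.extend (Prod.map r c) (Function.uncurry P) 0)) hdvd
  rw [eval_extend_minorPolynomial hr hc, eval_minorPolynomial, Matrix.det_eq_zero_of_row_eq_zero 0,
    zero_dvd_iff] at h
  · simp [P, Matrix.det_permutation] at h
  · intro j
    have hP : P (Fin.succ 0) j.succ = 0 := by simp [P, (Fin.succ_ne_zero j).symm]
    exact ((hr.prodMap hc).extend_apply _ _ (Fin.succ 0, j.succ)).trans hP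

theorem irreducible_minorPolynomial [IsDomain S] {k : ℕ} {r : Fin (k + 1) → μ}
    {c : Fin (k + 1) → ν} (hr : r.Injective) (hc : c.Injective) :
    Irreducible (minorPolynomial S r c) := by
  induction k with
  | zero =>
    rw [minorPolynomial, Matrix.det_fin_one]
    exact (MvPolynomial.X_prime).irreducible
  | succ k ih =>
    have hirr := ih (hr.comp (Fin.succ_injective _)) (hc.comp (Fin.succ_injective _))
    have hdvd := not_minorPolynomial_succ_dvd (S := S) hr hc
    have hsucc := minorPolynomial_succ (S := S) r c
    have hmem (c' : Fin (k + 1) → ν) : minorPolynomial S (r ∘ Fin.succ) c' ∈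
        MvPolynomial.supported S {(r 0, c 0)}ᶜ :=
      minorPolynomial_mem_supported fun i j h => Fin.succ_ne_zero i (hr (Prod.ext_iff.mp h).1)
    rw [hsucc] at hdvd ⊢
    refine MvPolynomial.irreducible_mul_X_add _ _ _ hirr.ne_zero
      (fun h => MvPolynomial.mem_supported.mp (hmem _) h rfl)
      (fun h => MvPolynomial.mem_supported.mp (sum_mem fun j _ => mul_mem (mul_mem ?_ ?_) (hmem _))
        h rfl)
      (hirr.isRelPrime_iff_not_dvd.mpr fun h => hdvd ((dvd_mul_right _ _).add h))
    · exact pow_mem (neg_mem (one_mem _)) _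
    · exact Algebra.subset_adjoin
        ⟨_, fun h => Fin.succ_ne_zero j (hc (Prod.ext_iff.mp h).2), rfl⟩

theorem not_minorPolynomial_dvd_of_ne [Nontrivial S] {m n : ℕ} {σ τ : Fin m ↪o Fin n}
    (hστ : σ ≠ τ) : ¬ minorPolynomial S (id : Fin m → Fin m) σ ∣ minorPolynomial S id τ := by
  intro hdvd
  obtain ⟨k, hk⟩ : ∃ k, σ k ∉ Set.range τ := by
    by_contra! hsub
    have hrange : Set.range σ = Set.range τ :=
      Set.eq_of_subset_of_ncard_le (Set.range_subset_iff.mpr hsub)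
        (by simp [Set.ncard_range_of_injective, σ.injective, τ.injective])
    exact hστ (DFunLike.coe_injective (σ.strictMono.range_inj τ.strictMono |>.mp hrange))
  have h := map_dvd (MvPolynomial.eval (Function.extend (Prod.map id τ)
    (Function.uncurry (1 : Matrix (Fin m) (Fin m) S)) 0)) hdvd
  rw [eval_extend_minorPolynomial Function.injective_id τ.injective, eval_minorPolynomial,
    Matrix.det_eq_zero_of_column_eq_zero k, zero_dvd_iff] at h
  · exact one_ne_zero (Matrix.det_one.symm.trans h)
  · intro i
    refine Function.extend_apply' _ _ _ ?_
    rintro ⟨q, hq⟩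
    exact hk ⟨q.2, (Prod.ext_iff.mp hq).2⟩

theorem squarefree_prod_minorPolynomial [IsDomain S] [UniqueFactorizationMonoid S] {m n : ℕ}
    (hm : 1 ≤ m) (s : Finset (Fin m ↪o Fin n)) :
    Squarefree (∏ σ ∈ s, minorPolynomial S id σ) := by
  obtain ⟨k, rfl⟩ := Nat.exists_eq_add_of_le' hm
  have hirr (σ : Fin (k + 1) ↪o Fin n) : Irreducible (minorPolynomial S id σ) :=
    irreducible_minorPolynomial Function.injective_id σ.injective
  exact Finset.squarefree_prod_of_pairwise_isCoprime
    (fun σ _ τ _ hστ => (hirr σ).isRelPrime_iff_not_dvd.mpr (not_minorPolynomial_dvd_of_ne hστ))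
    fun σ _ => (hirr σ).squarefree

end MinorPolynomial

/-! ### The Lie algebra of the acting group -/

section KroneckerSum

open scoped Kronecker

variable {μ ν S : Type*} [DecidableEq μ] [DecidableEq ν] [CommRing S]

/-- The linear vector field `M ↦ U * M + M * V` on the space of `μ × ν` matrices `M`, as a matrix
acting on the entries of `M`. The kernel of the map sending `(U, V)` to this field consists of the
scalars `(a, -a)`. -/
def kroneckerSum : Matrix μ μ S × Matrix ν ν S →ₗ[S] Matrix (μ × ν) (μ × ν) S where
  toFun UV := UV.1 ⊗ₖ 1 + 1 ⊗ₖ UV.2ᵀ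
  map_add' UV UV' := by
    simp only [Prod.fst_add, Prod.snd_add, Matrix.add_kronecker, Matrix.transpose_add,
      Matrix.kronecker_add]
    abel
  map_smul' a UV := by
    simp only [Prod.smul_fst, Prod.smul_snd, Matrix.smul_kronecker, Matrix.transpose_smul,
      Matrix.kronecker_smul, smul_add, RingHom.id_apply]

theorem kroneckerSum_apply (U : Matrix μ μ S) (V : Matrix ν ν S) (i k : μ) (j l : ν) :
    kroneckerSum (U, V) (i, j) (k, l) =
      U i k * (1 : Matrix ν ν S) l j + (1 : Matrix μ μ S) i k * V l j := by
  simp [kroneckerSum, Matrix.one_apply, eq_comm]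

theorem ker_kroneckerSum [Nonempty μ] [Nonempty ν] :
    LinearMap.ker (kroneckerSum (μ := μ) (ν := ν) (S := S)) = S ∙ (1, -1) := by
  ext ⟨U, V⟩
  rw [LinearMap.mem_ker, Submodule.mem_span_singleton]
  constructor
  · intro h
    obtain ⟨i₀⟩ := ‹Nonempty μ›
    obtain ⟨j₀⟩ := ‹Nonempty ν›
    have hUV (i k j l) :
        U i k * (1 : Matrix ν ν S) l j + (1 : Matrix μ μ S) i k * V l j = 0 := by
      rw [← kroneckerSum_apply, h, Matrix.zero_apply]
    have h₀ := hUV i₀ i₀ j₀ j₀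
    rw [Matrix.one_apply_eq, Matrix.one_apply_eq] at h₀
    refine ⟨U i₀ i₀, Prod.ext (Matrix.ext fun i k => ?_) (Matrix.ext fun l j => ?_)⟩
    · have hU := hUV i k j₀ j₀
      rw [Matrix.one_apply_eq] at hU
      change U i₀ i₀ * (1 : Matrix μ μ S) i k = U i k
      linear_combination (1 : Matrix μ μ S) i k * h₀ - hU
    · have hV := hUV i₀ i₀ j l
      rw [Matrix.one_apply_eq] at hV
      change U i₀ i₀ * -(1 : Matrix ν ν S) l j = V l j
      linear_combination -hV
  · rintro ⟨a, ha⟩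
    obtain ⟨rfl, rfl⟩ := Prod.ext_iff.mp ha.symm
    ext ⟨i, j⟩ ⟨k, l⟩
    simp [kroneckerSum_apply, mul_assoc, mul_left_comm a]

theorem finrank_map_kroneckerSum {K : Type*} [Field K] [Fintype μ] [Finite ν] [Nonempty μ]
    [Nonempty ν] {V : Submodule K (Matrix ν ν K)} (h1 : 1 ∈ V) :
    Module.finrank K ((Submodule.prod (⊤ : Submodule K (Matrix μ μ K)) V).map kroneckerSum) + 1 =
      Fintype.card μ ^ 2 + Module.finrank K V := by
  let f : Matrix μ μ K × V →ₗ[K] Matrix μ μ K × Matrix ν ν K :=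
    LinearMap.prodMap LinearMap.id V.subtype
  have hf : Function.Injective f := Function.injective_id.prodMap V.injective_subtype
  have hrange : LinearMap.range (kroneckerSum ∘ₗ f) =
      (Submodule.prod ⊤ V).map kroneckerSum := by
    rw [LinearMap.range_comp, LinearMap.range_prodMap, LinearMap.range_id, Submodule.range_subtype]
  have hker : LinearMap.ker (kroneckerSum ∘ₗ f) = K ∙ (1, -⟨1, h1⟩) := by
    rw [LinearMap.ker_comp, ker_kroneckerSum, ← Submodule.comap_map_eq_of_injective hf (K ∙ _),
      Submodule.map_span, Set.image_singleton]
    rfl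
  have hne : ((1, -⟨1, h1⟩) : Matrix μ μ K × V) ≠ 0 := fun h => one_ne_zero (Prod.ext_iff.mp h).1
  rw [← hrange, ← finrank_span_singleton (K := K) hne, ← hker,
    LinearMap.finrank_range_add_finrank_ker, Module.finrank_prod, Module.finrank_matrix, sq]
  simp

end KroneckerSum

section SupportedMatrices

variable {ν S : Type*} [CommRing S] {Q : Finset (ν × ν)}

/-- The matrices all of whose entries outside `Q` vanish; for a reflexive and transitive `Q`, this
is the Lie algebra of `quiverGroup Q`. -/
def supportedMatrices (S : Type*) [CommRing S] (Q : Finset (ν × ν)) :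
    Submodule S (Matrix ν ν S) where
  carrier := {V | ∀ i j, (i, j) ∉ Q → V i j = 0}
  zero_mem' _ _ _ := rfl
  add_mem' hV hW i j hij := by rw [Matrix.add_apply, hV i j hij, hW i j hij, add_zero]
  smul_mem' a V hV i j hij := by rw [Matrix.smul_apply, hV i j hij, smul_zero]

theorem finrank_supportedMatrices [StrongRankCondition S] :
    Module.finrank S (supportedMatrices S Q) = Q.card := by
  classical
  let e : supportedMatrices S Q ≃ₗ[S] (Q → S) :=
    { toFun V q := (V : Matrix ν ν S) q.1.1 q.1.2
      map_add' _ _ := rfl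
      map_smul' _ _ := rfl
      invFun f := ⟨Matrix.of fun i j => if h : (i, j) ∈ Q then f ⟨(i, j), h⟩ else 0,
        fun i j hij => dif_neg hij⟩
      left_inv V := by
        ext i j
        by_cases h : (i, j) ∈ Q
        · simp [h]
        · simp [h, V.2 i j h]
      right_inv f := funext fun q => dif_pos q.2 }
  rw [e.finrank_eq, Module.finrank_fintype_fun_eq_card, Fintype.card_coe]

theorem one_mem_supportedMatrices [DecidableEq ν] (hQ : ∀ i, (i, i) ∈ Q) :
    1 ∈ supportedMatrices S Q := by
  intro i j hij
  refine Matrix.one_apply_ne ?_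
  rintro rfl
  exact hij (hQ i)

end SupportedMatrices

section ActingLieAlgebra

open scoped Kronecker

variable {m n : ℕ} {R : Subgroup (GL (Fin n) ℂ)}

theorem actHom_mulVec (g : GL (Fin m) ℂ × R) (x : Fin m × Fin n → ℂ) :
    (actHom R g : Matrix (Fin m × Fin n) (Fin m × Fin n) ℂ) *ᵥ x = actLin g x :=
  LinearMap.toMatrix'_mulVec (actLin g) x

theorem actHom_eq_kronecker (g : GL (Fin m) ℂ × R) :
    (actHom R g : Matrix (Fin m × Fin n) (Fin m × Fin n) ℂ) =
      (g.1 : Matrix (Fin m) (Fin m) ℂ) ⊗ₖ (((g.2⁻¹ : R) : GL (Fin n) ℂ) : Matrix _ _ ℂ)ᵀ := by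
  refine Matrix.toLin'.injective (LinearMap.ext fun x => ?_)
  rw [Matrix.toLin'_apply, Matrix.toLin'_apply, actHom_mulVec]
  refine Eq.trans ?_ (Matrix.kronecker_mulVec_vec _ (toMat x)ᵀ _).symm
  rw [← Matrix.transpose_mul, ← Matrix.transpose_mul, ← Matrix.mul_assoc]
  rfl

variable {X : Matrix (Fin m × Fin n) (Fin m × Fin n) ℂ}

section Tangent

variable (hX : X ∈ actingLieAlgebra m R)

include hX

theorem apply_eq_zero_of_mem_actingLieAlgebra {l j : Fin n}
    (hR : ∀ B ∈ R, (B : Matrix (Fin n) (Fin n) ℂ) l j = 0) (i k : Fin m) :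
    X (i, j) (k, l) = 0 := by
  have h := mem_lieAlgebraOf_iff.mp hX (MvPolynomial.X ((i, j), (k, l))) (by
    rintro _ ⟨g, rfl⟩
    rw [MvPolynomial.eval_X, actHom_eq_kronecker, Matrix.kronecker_apply, Matrix.transpose_apply,
      hR _ (g.2⁻¹).2, mul_zero])
  simpa [fderiv_apply] using h

/- The group consists of rank one tensors `A ⊗ Bᵀ`, so its Lie algebra satisfies the linearized
Segre relations. -/
theorem apply_eq_of_mem_actingLieAlgebra (i k i₀ : Fin m) (j l j₀ : Fin n) :
    X (i, j) (k, l) = X (i, j₀) (k, j₀) * (1 : Matrix (Fin n) (Fin n) ℂ) l j +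
      (1 : Matrix (Fin m) (Fin m) ℂ) i k * X (i₀, j) (i₀, l) -
        (1 : Matrix (Fin m) (Fin m) ℂ) i k * (1 : Matrix (Fin n) (Fin n) ℂ) l j *
          X (i₀, j₀) (i₀, j₀) := by
  have h := mem_lieAlgebraOf_iff.mp hX
    (MvPolynomial.X ((i, j), (k, l)) * MvPolynomial.X ((i₀, j₀), (i₀, j₀)) -
      MvPolynomial.X ((i, j₀), (k, j₀)) * MvPolynomial.X ((i₀, j), (i₀, l))) (by
    rintro _ ⟨g, rfl⟩
    simp only [map_sub, map_mul, MvPolynomial.eval_X, actHom_eq_kronecker, Matrix.kronecker_apply]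
    ring)
  simp only [map_sub, map_mul, MvPolynomial.eval_X] at h
  rw [(((hasFDerivAt_apply _ _).fun_mul (hasFDerivAt_apply _ _)).fun_sub
    ((hasFDerivAt_apply _ _).fun_mul (hasFDerivAt_apply _ _))).fderiv] at h
  have hsymm : (1 : Matrix (Fin n) (Fin n) ℂ) j l = (1 : Matrix (Fin n) (Fin n) ℂ) l j := by
    simp [Matrix.one_apply, eq_comm]
  simp only [← Matrix.one_kronecker_one, Matrix.kronecker_apply, Matrix.one_apply_eq, one_smul,
    mul_one, one_mul, _root_.sub_apply, _root_.add_apply, _root_.smul_apply,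
    ContinuousLinearMap.proj_apply, smul_eq_mul, hsymm] at h
  linear_combination h

end Tangent

theorem exists_kroneckerSum_eq_of_mem_actingLieAlgebra (hm : 1 ≤ m) (hn : 1 ≤ n)
    (hX : X ∈ actingLieAlgebra m R) :
    ∃ U V, (∀ l j, (∀ B ∈ R, (B : Matrix _ _ ℂ) l j = 0) → V l j = 0) ∧
      kroneckerSum (U, V) = X := by
  have i₀ : Fin m := ⟨0, hm⟩
  have j₀ : Fin n := ⟨0, hn⟩
  refine ⟨Matrix.of fun i k => X (i, j₀) (k, j₀) -
      (1 : Matrix (Fin m) (Fin m) ℂ) i k * X (i₀, j₀) (i₀, j₀),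
    Matrix.of fun l j => X (i₀, j) (i₀, l),
    fun l j h => apply_eq_zero_of_mem_actingLieAlgebra hX h i₀ i₀, ?_⟩
  ext ⟨i, j⟩ ⟨k, l⟩
  rw [apply_eq_of_mem_actingLieAlgebra hX i k i₀ j l j₀, kroneckerSum_apply]
  simp only [Matrix.of_apply]
  ring

theorem eventually_det_one_add_smul_ne_zero {ι : Type*} [Fintype ι] [DecidableEq ι]
    (Y : Matrix ι ι ℂ) : ∀ᶠ t : ℂ in nhds 0, (1 + t • Y).det ≠ 0 := by
  have hcont : Continuous fun t : ℂ => (1 + t • Y).det := by fun_prop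
  exact hcont.continuousAt.eventually_ne (by simp)

theorem kroneckerSum_mem_actingLieAlgebra (U : Matrix (Fin m) (Fin m) ℂ)
    {V : Matrix (Fin n) (Fin n) ℂ}
    (hV : ∀ᶠ t : ℂ in nhds 0, ∃ B ∈ R, (B : Matrix (Fin n) (Fin n) ℂ) = 1 + t • V) :
    kroneckerSum (U, V) ∈ actingLieAlgebra m R := by
  refine mem_lieAlgebraOf_of_hasDerivAt (c := fun t => (1 + t • U) ⊗ₖ (1 + t • V)ᵀ)
    (by simp) ?_ ?_
  · rintro ⟨i, j⟩ ⟨k, l⟩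
    have hU : HasDerivAt (fun t : ℂ => (1 + t • U) i k) (U i k) 0 := by
      simpa using ((hasDerivAt_id (0 : ℂ)).mul_const (U i k)).const_add ((1 : Matrix _ _ ℂ) i k)
    have hV : HasDerivAt (fun t : ℂ => (1 + t • V) l j) (V l j) 0 := by
      simpa using ((hasDerivAt_id (0 : ℂ)).mul_const (V l j)).const_add ((1 : Matrix _ _ ℂ) l j)
    refine (hU.fun_mul hV).congr_deriv ?_
    simp [kroneckerSum_apply]
  · filter_upwards [eventually_det_one_add_smul_ne_zero U, hV] with t hU ⟨B, hB, hBt⟩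
    refine ⟨_, ⟨(Matrix.GeneralLinearGroup.mkOfDetNeZero _ hU, (⟨B, hB⟩⁻¹ : R)), rfl⟩, ?_⟩
    rw [actHom_eq_kronecker, inv_inv, ← hBt]
    rfl

variable {Q : Finset (Fin n × Fin n)} (hrefl : ∀ i, (i, i) ∈ Q)
  (htrans : ∀ i j k, (i, j) ∈ Q → (j, k) ∈ Q → (i, k) ∈ Q)

theorem actingLieAlgebra_quiverGroup (hm : 1 ≤ m) (hn : 1 ≤ n) :
    actingLieAlgebra m (quiverGroup Q hrefl htrans) =
      (Submodule.prod ⊤ (supportedMatrices ℂ Q)).map kroneckerSum := by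
  ext X
  constructor
  · intro hX
    obtain ⟨U, V, hV, rfl⟩ := exists_kroneckerSum_eq_of_mem_actingLieAlgebra hm hn hX
    exact ⟨(U, V), ⟨trivial, fun l j hlj => hV l j fun B hB => hB l j hlj⟩, rfl⟩
  · rintro ⟨⟨U, V⟩, ⟨-, hV⟩, rfl⟩
    refine kroneckerSum_mem_actingLieAlgebra U ?_
    filter_upwards [eventually_det_one_add_smul_ne_zero V] with t ht
    exact ⟨Matrix.GeneralLinearGroup.mkOfDetNeZero _ ht,
      (supportedMatrices ℂ Q).add_mem (one_mem_supportedMatrices hrefl)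
        ((supportedMatrices ℂ Q).smul_mem t hV), rfl⟩

theorem finrank_actingLieAlgebra_quiverGroup (hm : 1 ≤ m) (hn : 1 ≤ n) :
    Module.finrank ℂ (actingLieAlgebra m (quiverGroup Q hrefl htrans)) + 1 = m ^ 2 + Q.card := by
  have : NeZero m := ⟨Nat.one_le_iff_ne_zero.mp hm⟩
  have : NeZero n := ⟨Nat.one_le_iff_ne_zero.mp hn⟩
  rw [actingLieAlgebra_quiverGroup hrefl htrans hm hn,
    finrank_map_kroneckerSum (one_mem_supportedMatrices hrefl), finrank_supportedMatrices,
    Fintype.card_fin]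

end ActingLieAlgebra

/-! ### Preserved minors -/

section PreservedMinors

variable {m n : ℕ} {R : Subgroup (GL (Fin n) ℂ)}

theorem minorDivisor_eq (σ : Fin m ↪o Fin n) :
    minorDivisor σ = {x | MvPolynomial.eval x (minorPolynomial ℂ id σ) = 0} := by
  simp only [eval_minorPolynomial]
  rfl

theorem isReducedEquation_prod_minorPolynomial (hm : 1 ≤ m) (s : Finset (Fin m ↪o Fin n)) :
    IsReducedEquation (fun x => MvPolynomial.eval x (∏ σ ∈ s, minorPolynomial ℂ id σ))
      (⋃ σ ∈ s, minorDivisor σ) := by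
  have hunion : ⋃ σ ∈ s, minorDivisor σ =
      {x | MvPolynomial.eval x (∏ σ ∈ s, minorPolynomial ℂ id σ) = 0} := by
    ext x
    simp [minorDivisor_eq, Finset.prod_eq_zero_iff]
  exact hunion ▸ isReducedEquation_of_squarefree (squarefree_prod_minorPolynomial hm s)

theorem eval_smul_prod_minorPolynomial (s : Finset (Fin m ↪o Fin n)) (t : ℂ)
    (x : Fin m × Fin n → ℂ) :
    MvPolynomial.eval (t • x) (∏ σ ∈ s, minorPolynomial ℂ id σ) =
      t ^ (m * s.card) * MvPolynomial.eval x (∏ σ ∈ s, minorPolynomial ℂ id σ) := by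
  simp only [MvPolynomial.eval_prod, eval_smul_minorPolynomial, Finset.prod_mul_distrib,
    Finset.prod_const, Fintype.card_fin, pow_mul]

theorem mulVec_mem_iUnion_preservedMinors {g : GL (Fin m × Fin n) ℂ}
    (hg : g ∈ (actHom (m := m) R).range) {x : Fin m × Fin n → ℂ}
    (hx : x ∈ ⋃ σ ∈ preservedMinors m R, minorDivisor σ) :
    (g : Matrix (Fin m × Fin n) (Fin m × Fin n) ℂ) *ᵥ x ∈
      ⋃ σ ∈ preservedMinors m R, minorDivisor σ := by
  obtain ⟨h, rfl⟩ := hg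
  obtain ⟨σ, hσ, hxσ⟩ := Set.mem_iUnion₂.mp hx
  rw [actHom_mulVec]
  exact Set.mem_biUnion hσ (hσ h ▸ Set.mem_image_of_mem _ hxσ)

theorem proposition76_general (hm : 1 ≤ m)
    (A : Module.Basis (Fin m × Fin n) ℂ (actingLieAlgebra m R)) :
    (discriminantDet A ≠ 0 → (preservedMinors m R).ncard = n →
        IsLinearFreeDivisor (⋃ σ ∈ preservedMinors m R, minorDivisor σ) ∧
        IsReducedEquation (fun x => MvPolynomial.eval x (discriminantDet A))
          (⋃ σ ∈ preservedMinors m R, minorDivisor σ)) ∧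
      (n < (preservedMinors m R).ncard → discriminantDet A = 0) := by
  obtain ⟨s, hs⟩ := (preservedMinors m R).toFinite.exists_finset_coe
  have hD := isReducedEquation_prod_minorPolynomial hm s
  have hH : ∀ g ∈ (actHom (m := m) R).range, ∀ x ∈ ⋃ σ ∈ s, minorDivisor σ,
      (g : Matrix (Fin m × Fin n) (Fin m × Fin n) ℂ) *ᵥ x ∈ ⋃ σ ∈ s, minorDivisor σ := by
    simp only [← Finset.mem_coe, hs]
    exact fun g hg x hx => mulVec_mem_iUnion_preservedMinors hg hx
  have hF := eval_smul_prod_minorPolynomial s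
  have hcard : Fintype.card (Fin m × Fin n) = m * n := by simp
  simp only [← hs, Set.ncard_coe_finset, Finset.mem_coe]
  constructor
  · intro hΔ hsn
    rw [hsn, ← hcard] at hF
    exact ⟨isLinearFreeDivisor_of_discriminantDet_ne_zero A hD hH hF hΔ,
      isReducedEquation_discriminantDet A hD hH hF hΔ⟩
  · intro hns
    exact discriminantDet_eq_zero_of_card_lt A hD hH hF
      (hcard.trans_lt (Nat.mul_lt_mul_of_pos_left hns hm))

end PreservedMinors

theorem proposition76 (m n : ℕ) (hm : 1 ≤ m) (hmn : m ≤ n)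
    (Q : Finset (Fin n × Fin n))
    (hcard : (Q.card : ℤ) = (m : ℤ) * n - (m : ℤ) ^ 2 + 1)
    (hrefl : ∀ i, (i, i) ∈ Q)
    (htrans : ∀ i j k, (i, j) ∈ Q → (j, k) ∈ Q → (i, k) ∈ Q) :
    Module.finrank ℂ (actingLieAlgebra m (quiverGroup Q hrefl htrans)) = m * n ∧
    ∀ A : Module.Basis (Fin m × Fin n) ℂ (actingLieAlgebra m (quiverGroup Q hrefl htrans)),
      (discriminantDet A ≠ 0 →
        (preservedMinors m (quiverGroup Q hrefl htrans)).ncard = n →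
          IsLinearFreeDivisor
            (⋃ σ ∈ preservedMinors m (quiverGroup Q hrefl htrans), minorDivisor σ) ∧
          IsReducedEquation (fun x => MvPolynomial.eval x (discriminantDet A))
            (⋃ σ ∈ preservedMinors m (quiverGroup Q hrefl htrans), minorDivisor σ)) ∧
      (n < (preservedMinors m (quiverGroup Q hrefl htrans)).ncard →
        discriminantDet A = 0) := by
  refine ⟨?_, proposition76_general hm⟩
  have h := finrank_actingLieAlgebra_quiverGroup hrefl htrans hm (hm.trans hmn)
  zify at h ⊢
  linarith
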